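/- Let $k$ be a perfect field of characteristic $p>0$. A local $k$-algebra is a noetherian local ring $A\supseteq k$, with maximal ideal $\mathfrak m_A$, such that $A/\mathfrak m_A$ is a finite extension of $k$. Put $$\overline\Omega^1_k(A):=\Omega^1_k(A)\Big/\bigcap_{i\ge 0}\mathfrak m_A^i\,\Omega^1_k(A)$$ (separated Kähler differentials; the same notation is used for any $k$-algebra that is a local ring). Let $\varphi:A\to B$ be a local homomorphism of local $k$-algebras. Assume that the completion $\widehat A$ is an integral domain, that $B$ is regular (hence an integral domain), and that the $B$-module $\overline\Omega^1_k(B)$ is finitely generated (which holds, for instance, if $B$ is complete). Differential rank. For $n\ge 0$ let $A_n:=\varphi^{-1}(B^{p^n})$, where $B^{p^n}=\{b^{p^n}: b\in B\}$; this is a $k$-algebra and a local ring. Let $\varphi_n:A_n\to B$ be the ring homomorphism with $\varphi_n(a)^{p^n}=\varphi(a)$ for all $a\in A_n$, and let $\varphi_n^1:\overline\Omega^1_k(A_n)\to\overline\Omega^1_k(B)$, $x\,dy\mapsto\varphi_n(x)\,d\varphi_n(y)$, be the induced map. Let $m_n$ be the rank of the $B$-submodule of $\overline\Omega^1_k(B)$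 generated by the image of $\varphi_n^1$, and define $\operatorname{drk}\varphi:=\lim_{n\to\infty}m_n$. Geometric rank. Let $\nu_B(b)=\max\{n: b\in\mathfrak m_B^n\}$ be the $\mathfrak m_B$-adic valuation, let $\nu$ be the valuation induced by $\nu_B\circ\varphi$ on the field of fractions of $A/\ker\varphi$, and let $k_\nu$ be the residue field of the valuation ring of $\nu$. Define $\operatorname{grk}\varphi:=\operatorname{tr.deg}_k k_\nu+1$ if $\nu$ is non-trivial, and $\operatorname{grk}\varphi:=\operatorname{tr.deg}_k k_\nu=0$ if $\nu$ is trivial (i.e. if $\varphi(\mathfrak m_A)=0$). Then the limit defining $\operatorname{drk}\varphi$ exists, and $\operatorname{grk}\varphi\ge\operatorname{drk}\varphi$. -/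

import Mathlib

namespace LocalRank

noncomputable section

/-! ### The pulled back subrings and the divided homomorphisms -/

section Frobenius

variable {k A B : Type*} [Field k] [CommRing A] [CommRing B] [Algebra k A] [Algebra k B]

theorem charP_of_algebra (k : Type*) {B : Type*} [Field k] [CommRing B] [Algebra k B] [Nontrivial B]
    (p : ℕ) [CharP k p] : CharP B p :=
  charP_of_injective_algebraMap (algebraMap k B).injective p

theorem exists_pow_eq (p : ℕ) [Fact p.Prime] [CharP k p] [PerfectField k] (n : ℕ) (c : k) :
    ∃ c' : k, c' ^ p ^ n = c := by
  have : ExpChar k p := ExpChar.prime Fact.out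
  have : PerfectRing k p := PerfectField.toPerfectRing p
  obtain ⟨c', h⟩ := (bijective_iterateFrobenius k p n).2 c
  exact ⟨c', by simpa [iterateFrobenius_def] using h⟩

variable [IsDomain B]

theorem pow_p_injective (k : Type*) {B : Type*} [Field k] [CommRing B] [Algebra k B] [IsDomain B]
    (p : ℕ) [Fact p.Prime] [CharP k p] (n : ℕ) {b b' : B} (h : b ^ p ^ n = b' ^ p ^ n) : b = b' := by
  have : CharP B p := charP_of_algebra k p
  have : ExpChar B p := ExpChar.prime Fact.out
  exact iterateFrobenius_inj B p n (by simpa [iterateFrobenius_def] using h)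

/-- The `k`-subalgebra `Aₙ = φ⁻¹(B ^ (p ^ n))` of `A`. -/
def frobPreimage (p : ℕ) [Fact p.Prime] [CharP k p] [PerfectField k] (φ : A →ₐ[k] B) (n : ℕ) :
    Subalgebra k A where
  carrier := {a | ∃ b : B, b ^ p ^ n = φ a}
  mul_mem' := by
    rintro x y ⟨b, hb⟩ ⟨c, hc⟩
    exact ⟨b * c, by rw [mul_pow, hb, hc, map_mul]⟩
  add_mem' := by
    rintro x y ⟨b, hb⟩ ⟨c, hc⟩
    have : CharP B p := charP_of_algebra k p
    exact ⟨b + c, by rw [add_pow_char_pow, hb, hc, map_add]⟩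
  algebraMap_mem' := by
    intro c
    obtain ⟨c', h⟩ := exists_pow_eq p n c
    exact ⟨algebraMap k B c', by rw [← map_pow, h, AlgHom.commutes]⟩

/-- The homomorphism `φₙ : Aₙ → B` with `φₙ ^ (p ^ n) = φ` on `Aₙ`. -/
def frobRoot (p : ℕ) [Fact p.Prime] [CharP k p] [PerfectField k] (φ : A →ₐ[k] B) (n : ℕ) :
    frobPreimage p φ n →+* B :=
  have key : ∀ (a : frobPreimage p φ n) (b : B), b ^ p ^ n = φ a → Classical.choose a.2 = b :=
    fun a b hb => pow_p_injective k p n ((Classical.choose_spec a.2).trans hb.symm)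
  have spec : ∀ a : frobPreimage p φ n, Classical.choose a.2 ^ p ^ n = φ a :=
    fun a => Classical.choose_spec a.2
  { toFun := fun a => Classical.choose a.2
    map_one' := key 1 1 (by simp)
    map_mul' := fun x y => key (x * y) _ (by rw [mul_pow, spec, spec]; simp)
    map_zero' := key 0 0 (by simp [(Fact.out : p.Prime).ne_zero])
    map_add' := fun x y => key (x + y) _ (by
      have : CharP B p := charP_of_algebra k p
      rw [add_pow_char_pow, spec, spec]; simp) }

theorem frobRoot_pow (p : ℕ) [Fact p.Prime] [CharP k p] [PerfectField k] (φ : A →ₐ[k] B) (n : ℕ)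
    (a : frobPreimage p φ n) : frobRoot p φ n a ^ p ^ n = φ a :=
  Classical.choose_spec a.2

/-- `φₙ` maps `k` into `k`, by `c ↦ c ^ (1 / p ^ n)`. -/
theorem frobRoot_algebraMap (p : ℕ) [Fact p.Prime] [CharP k p] [PerfectField k] (φ : A →ₐ[k] B)
    (n : ℕ) (c : k) :
    ∃ c' : k, frobRoot p φ n (algebraMap k (frobPreimage p φ n) c) = algebraMap k B c' := by
  obtain ⟨c', h⟩ := exists_pow_eq p n c
  refine ⟨c', pow_p_injective k p n ?_⟩
  rw [frobRoot_pow, ← map_pow, h]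
  exact φ.commutes c

instance frobPreimage_subtype_isLocalHom (p : ℕ) [Fact p.Prime] [CharP k p] [PerfectField k]
    (φ : A →ₐ[k] B) (n : ℕ) : IsLocalHom (algebraMap (frobPreimage p φ n) A) where
  map_nonunit := by
    rintro ⟨a, b, hb⟩ ha
    change IsUnit a at ha
    obtain ⟨a', ha'⟩ := ha.exists_right_inv
    have hu : IsUnit b := by
      have : IsUnit (b ^ p ^ n) := hb ▸ ha.map φ
      exact (isUnit_pow_iff (pow_ne_zero _ (Fact.out : p.Prime).ne_zero)).1 this
    obtain ⟨b', hb'⟩ := hu.exists_right_inv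
    have h1 : φ a * b' ^ p ^ n = 1 := by rw [← hb, ← mul_pow, hb', one_pow]
    have h2 : φ a * φ a' = 1 := by rw [← map_mul, ha', map_one]
    refine IsUnit.of_mul_eq_one (⟨a', b', ?_⟩ : frobPreimage p φ n) (Subtype.ext ha')
    exact (ha.map φ).mul_left_cancel (h1.trans h2.symm)

instance frobPreimage_isLocalRing [IsLocalRing A] (p : ℕ) [Fact p.Prime] [CharP k p]
    [PerfectField k] (φ : A →ₐ[k] B) (n : ℕ) : IsLocalRing (frobPreimage p φ n) :=
  (algebraMap (frobPreimage p φ n) A).domain_isLocalRing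

instance frobRoot_isLocalHom (p : ℕ) [Fact p.Prime] [CharP k p] [PerfectField k]
    (φ : A →ₐ[k] B) [IsLocalHom φ] (n : ℕ) : IsLocalHom (frobRoot p φ n) where
  map_nonunit := by
    intro a ha
    have h : IsUnit (φ a) := by
      rw [← frobRoot_pow]; exact ha.pow _
    exact IsUnit.of_map (algebraMap (frobPreimage p φ n) A) a (IsUnit.of_map φ (a : A) h)

end Frobenius

/-! ### Separated Kähler differentials -/

section Kaehler

open KaehlerDifferential

variable (k : Type*) {A B : Type*} [Field k] [CommRing A] [CommRing B] [Algebra k A]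

/-- The semilinear map on `Ω¹ₖ(A)` that belongs to a derivation `δ` of `A` over `k` with values in a
`B`-module, on which `A` acts through the ring homomorphism `f`. -/
def kaehlerLift {N : Type*} [AddCommGroup N] [Module B N] (f : A →+* B) (δ : A →+ N)
    (hk : ∀ c : k, δ (algebraMap k A c) = 0)
    (hmul : ∀ x y : A, δ (x * y) = f x • δ y + f y • δ x) :
    Ω[A⁄k] →ₛₗ[f] N :=
  letI : Module A N := Module.compHom N f
  letI : Module k N := Module.compHom N (algebraMap k A)
  haveI : IsScalarTower k A N := ⟨fun c a x => by
    rw [Algebra.smul_def, mul_smul]; rfl⟩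
  let D : Derivation k A N :=
    { toFun := δ
      map_add' := δ.map_add
      map_smul' := fun c x => by
        rw [Algebra.smul_def, hmul, hk, smul_zero, add_zero]; rfl
      map_one_eq_zero' := by simpa using hk 1
      leibniz' := hmul }
  { toFun := D.liftKaehlerDifferential
    map_add' := map_add _
    map_smul' := fun a x => map_smul D.liftKaehlerDifferential a x }

theorem kaehlerLift_D {N : Type*} [AddCommGroup N] [Module B N] (f : A →+* B) (δ : A →+ N)
    (hk : ∀ c : k, δ (algebraMap k A c) = 0)
    (hmul : ∀ x y : A, δ (x * y) = f x • δ y + f y • δ x) (a : A) :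
    kaehlerLift k f δ hk hmul (D k A a) = δ a := by
  let : Module A N := Module.compHom N f
  let : Module k N := Module.compHom N (algebraMap k A)
  have : IsScalarTower k A N := ⟨fun c a x => by
    rw [Algebra.smul_def, mul_smul]; rfl⟩
  exact Derivation.liftKaehlerDifferential_comp_D (R := k) (S := A) (M := N) _ a

variable [Algebra k B]

/-- The map `Ω¹ₖ(A) → Ω¹ₖ(B)`, `x dy ↦ f(x) d(f(y))`, over a ring homomorphism `f` that maps `k`
into `k` (not necessarily by the identity). -/
def kaehlerMap (f : A →+* B) (hf : ∀ c : k, ∃ c' : k, f (algebraMap k A c) = algebraMap k B c') :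
    Ω[A⁄k] →ₛₗ[f] Ω[B⁄k] :=
  kaehlerLift k f ((D k B).toLinearMap.toAddMonoidHom.comp f.toAddMonoidHom)
    (fun c => by
      obtain ⟨c', h⟩ := hf c
      change D k B (f (algebraMap k A c)) = 0
      rw [h, Derivation.map_algebraMap])
    (fun x y => by
      change D k B (f (x * y)) = f x • D k B (f y) + f y • D k B (f x)
      rw [map_mul, Derivation.leibniz])

theorem kaehlerMap_D (f : A →+* B)
    (hf : ∀ c : k, ∃ c' : k, f (algebraMap k A c) = algebraMap k B c') (a : A) :
    kaehlerMap k f hf (D k A a) = D k B (f a) :=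
  kaehlerLift_D k f _ _ _ a

variable (A) in
/-- The submodule `⋂ᵢ 𝔪ⁱ Ω¹ₖ(A)` of `Ω¹ₖ(A)`. -/
def kaehlerInf [IsLocalRing A] : Submodule A (Ω[A⁄k]) :=
  ⨅ i : ℕ, (IsLocalRing.maximalIdeal A ^ i) • (⊤ : Submodule A (Ω[A⁄k]))

variable (A) in
/-- The module of separated Kähler differentials `Ω¹ₖ(A) / ⋂ᵢ 𝔪ⁱ Ω¹ₖ(A)`. -/
abbrev SepKaehler [IsLocalRing A] : Type _ := Ω[A⁄k] ⧸ kaehlerInf k A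

theorem kaehlerInf_le_comap [IsLocalRing A] [IsLocalRing B] (f : A →+* B) [IsLocalHom f]
    (hf : ∀ c : k, ∃ c' : k, f (algebraMap k A c) = algebraMap k B c') :
    kaehlerInf k A ≤ (kaehlerInf k B).comap (kaehlerMap k f hf) := by
  intro x hx
  rw [Submodule.mem_comap, kaehlerInf, Submodule.mem_iInf]
  intro i
  have hx' := (Submodule.mem_iInf _).1 hx i
  refine Submodule.smul_induction_on hx' ?_ ?_
  · intro r hr y _
    rw [map_smulₛₗ]
    refine Submodule.smul_mem_smul ?_ trivial
    have h1 : (IsLocalRing.maximalIdeal A).map f ≤ IsLocalRing.maximalIdeal B :=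
      ((IsLocalRing.local_hom_TFAE f).out 0 2).1 ‹IsLocalHom f›
    have h2 := Ideal.mem_map_of_mem f hr
    rw [Ideal.map_pow] at h2
    exact Ideal.pow_right_mono h1 i h2
  · intro y z hy hz
    rw [map_add]
    exact add_mem hy hz

/-- The map `f¹` induced by `f` on separated Kähler differentials. -/
def sepKaehlerMap [IsLocalRing A] [IsLocalRing B] (f : A →+* B) [IsLocalHom f]
    (hf : ∀ c : k, ∃ c' : k, f (algebraMap k A c) = algebraMap k B c') :
    SepKaehler k A →ₛₗ[f] SepKaehler k B :=
  Submodule.mapQ _ _ (kaehlerMap k f hf) (kaehlerInf_le_comap k f hf)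

theorem sepKaehlerMap_D [IsLocalRing A] [IsLocalRing B] (f : A →+* B) [IsLocalHom f]
    (hf : ∀ c : k, ∃ c' : k, f (algebraMap k A c) = algebraMap k B c') (a : A) :
    sepKaehlerMap k f hf (Submodule.Quotient.mk (D k A a)) = Submodule.Quotient.mk (D k B (f a)) :=
  congrArg Submodule.Quotient.mk (kaehlerMap_D k f hf a)

end Kaehler

/-! ### The differential rank -/

section DifferentialRank

variable {k A B : Type*} [Field k] [CommRing A] [CommRing B] [Algebra k A] [Algebra k B]
  [IsLocalRing A] [IsLocalRing B] [IsDomain B]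

/-- The `B`-submodule `B φₙ¹(Ω̄¹ₖ(Aₙ))` of `Ω̄¹ₖ(B)`. -/
def imageSpan (p : ℕ) [Fact p.Prime] [CharP k p] [PerfectField k] (φ : A →ₐ[k] B) [IsLocalHom φ]
    (n : ℕ) : Submodule B (SepKaehler k B) :=
  Submodule.span B
    (Set.range (sepKaehlerMap k (frobRoot p φ n) (frobRoot_algebraMap p φ n)))

/-- The number `mₙ`, the rank of the `B`-module `B φₙ¹(Ω̄¹ₖ(Aₙ))`. -/
def rankSeq (p : ℕ) [Fact p.Prime] [CharP k p] [PerfectField k] (φ : A →ₐ[k] B) [IsLocalHom φ]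
    (n : ℕ) : ℕ :=
  Module.finrank B (imageSpan p φ n)

/-- The differential rank `drk φ`, the limit of the sequence `mₙ`. -/
def drk (p : ℕ) [Fact p.Prime] [CharP k p] [PerfectField k] (φ : A →ₐ[k] B) [IsLocalHom φ] : ℕ :=
  Filter.limUnder Filter.atTop (rankSeq p φ)

end DifferentialRank

/-! ### The geometric rank -/

section GeometricRank

variable {k A B : Type*} [Field k] [CommRing A] [CommRing B] [Algebra k A] [Algebra k B]
  [IsLocalRing B] [IsDomain B]

/-- The `𝔪`-adic order `ν_B(b) = max {n | b ∈ 𝔪ⁿ}`, with `ν_B(0) = ∞`. -/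
def ord {B : Type*} [CommRing B] [IsLocalRing B] (b : B) : ℕ∞ :=
  ⨆ (n : ℕ) (_ : b ∈ IsLocalRing.maximalIdeal B ^ n), (n : ℕ∞)

/-- The valuation ring of `ν = ν_B ∘ φ` on the field of fractions of `A / ker φ ≅ φ(A)`, viewed
inside the field of fractions of `B`. When `B` is regular, `ν_B` is a valuation and the generating
set below is already the whole subalgebra. -/
def valRing (φ : A →ₐ[k] B) : Subalgebra k (FractionRing B) :=
  Algebra.adjoin k {x | ∃ a b : A, φ b ≠ 0 ∧ ord (φ b) ≤ ord (φ a) ∧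
    x = algebraMap B (FractionRing B) (φ a) / algebraMap B (FractionRing B) (φ b)}

/-- The maximal ideal of the valuation ring of `ν`. When `B` is regular, the generating set below is
already the whole ideal. -/
def valIdeal (φ : A →ₐ[k] B) : Ideal (valRing φ) :=
  Ideal.span {x | ∃ a b : A, φ b ≠ 0 ∧ ord (φ b) < ord (φ a) ∧
    (x : FractionRing B) =
      algebraMap B (FractionRing B) (φ a) / algebraMap B (FractionRing B) (φ b)}

open Classical in
/-- The geometric rank `grk φ`: the transcendence degree over `k` of the residue field of `ν`, plus
the rank of the value group of `ν`, which is `1`, or `0` if `ν` is trivial, that is, if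
`φ` vanishes on the maximal ideal of `A`. -/
def grk [IsLocalRing A] (φ : A →ₐ[k] B) : Cardinal :=
  Algebra.trdeg k (valRing φ ⧸ valIdeal φ) +
    if ∃ a ∈ IsLocalRing.maximalIdeal A, φ a ≠ 0 then 1 else 0

end GeometricRank

end

end LocalRank

/-! Let d = dim B, let 𝔪 be the maximal ideal of B and x a regular system of parameters. Such an x
is quasi-regular (`isQuasiRegular_of_span_range_eq_maximalIdeal`), so gr B is a polynomial ring in d
variables over the residue field. Hence orders are additive, and initial forms can be compared in E
= Frac(gr B), which has transcendence degree at least d over k.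

Let r = mₙ. Choose f₁, …, f_r in φₙ(Aₙ) whose differentials are independent over Frac B. Dualizing
and clearing denominators gives derivations Dᵢ of B with Dᵢ fⱼ = δᵢⱼ h and h ≠ 0. A derivation
lowers orders by at most one, and a polynomial with zero gradient is a p-th power because k is
perfect. So ord P(f) is bounded linearly in deg P for P ≠ 0 (`eq_zero_of_aeval_mem_pow`).

Ratios of initial forms of equal degree coming from φ(A) lie in an image S of the residue ring of ν.
Adjoining one initial form g of positive degree gives A₁ = S[g] ⊆ E, with tr.deg A₁ ≤ tr.deg k_ν +
1. As P(f)^(pⁿ) ∈ φ(A), the initial forms of all P(f) are algebraic over A₁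
(`isAlgebraic_initialFrac`). Let s of the variables form a transcendence basis of E over A₁, so that
d ≤ grk φ + s. In a sum ∑ P_α(f) x^α over the corresponding s parameters, initial forms cannot
cancel (`coeff_mem_pow_of_eval_mem_pow`), so the linear order bound extends to these r + s elements.
Since dim B/𝔪^M = O(M^d), at most d elements can obey such a bound
(`card_le_of_forall_aeval_mem_pow`). Thus r + s ≤ d ≤ grk φ + s, and s is finite.

The limit exists because φₙ₊₁(a^p) = φₙ(a) makes the spans increase, with ranks bounded by that of
the differentials of B. -/

namespace LocalRank

/-! ### Regular local rings are domains -/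

section RegularDomain

open IsLocalRing

theorem map_maximalIdeal_quotient {R : Type*} [CommRing R] [IsLocalRing R] (I : Ideal R)
    [IsLocalRing (R ⧸ I)] :
    (maximalIdeal R).map (Ideal.Quotient.mk I) = maximalIdeal (R ⧸ I) := by
  have : IsLocalHom (Ideal.Quotient.mk I) :=
    IsLocalHom.of_surjective _ Ideal.Quotient.mk_surjective
  refine le_antisymm (((local_hom_TFAE _).out 0 2).1 this) ?_
  intro y hy
  obtain ⟨z, rfl⟩ := Ideal.Quotient.mk_surjective y
  refine Ideal.mem_map_of_mem _ ?_
  rw [mem_maximalIdeal, mem_nonunits_iff] at hy ⊢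
  exact fun h => hy (h.map _)

theorem isLocalRing_quotient {R : Type*} [CommRing R] [IsLocalRing R] {I : Ideal R}
    (hI : I ≤ maximalIdeal R) : IsLocalRing (R ⧸ I) :=
  have : Nontrivial (R ⧸ I) :=
    Ideal.Quotient.nontrivial_iff.2 fun h =>
      (maximalIdeal.isMaximal R).ne_top (top_le_iff.1 (h ▸ hI))
  IsLocalRing.of_surjective' _ Ideal.Quotient.mk_surjective

theorem ringKrullDim_le_of_span_range_eq_maximalIdeal {R : Type*} [CommRing R] [IsLocalRing R]
    [IsNoetherianRing R] {d : ℕ} (x : Fin d → R)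
    (hx : Ideal.span (Set.range x) = maximalIdeal R) : ringKrullDim R ≤ d := by
  refine (ringKrullDim_le_spanFinrank_maximalIdeal R).trans ?_
  rw [← hx]
  have h1 := Submodule.spanFinrank_span_le_ncard_of_finite (R := R) (Set.finite_range x)
  have h2 : (Set.range x).ncard ≤ d := by
    have := Set.ncard_image_le (f := x) (Set.finite_univ)
    simpa [Set.image_univ] using this
  exact_mod_cast h1.trans h2

theorem exists_isPrime_le_ringKrullDim_quotient {R : Type*} [CommRing R] {d : ℕ}
    (hd : (d : WithBot ℕ∞) ≤ ringKrullDim R) :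
    ∃ q : Ideal R, q.IsPrime ∧ (d : WithBot ℕ∞) ≤ ringKrullDim (R ⧸ q) := by
  obtain ⟨l, hl⟩ := Order.le_krullDim_iff.1 hd
  refine ⟨l.head.asIdeal, l.head.2, ?_⟩
  rw [ringKrullDim_quotient]
  refine Order.le_krullDim_iff.2 ⟨⟨l.length, fun i => ⟨l i, ?_⟩, fun i => l.step i⟩, hl⟩
  exact l.head_le i

theorem ringKrullDim_le_quotient_singleton {R : Type*} [CommRing R] [IsLocalRing R]
    [IsNoetherianRing R] {d : ℕ} {x : R} (hx : x ∈ maximalIdeal R)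
    (hd : ((d + 1 : ℕ) : WithBot ℕ∞) ≤ ringKrullDim R) :
    (d : WithBot ℕ∞) ≤ ringKrullDim (R ⧸ Ideal.span {x}) := by
  have h := ringKrullDim_le_ringKrullDim_quotient_add_card ({x} : Finset R) (by
    rw [IsLocalRing.ringJacobson_eq_maximalIdeal]; simpa using hx)
  rw [Finset.coe_singleton, Finset.card_singleton] at h
  have h' := hd.trans h
  push_cast at h'
  exact ENat.WithBot.add_le_add_one_right_iff.1 h'

theorem span_range_quotient_head {R : Type*} [CommRing R] [IsLocalRing R] {d : ℕ}
    (x : Fin (d + 1) → R) (hx : Ideal.span (Set.range x) = maximalIdeal R) (I : Ideal R)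
    (h0 : x 0 ∈ I) [IsLocalRing (R ⧸ I)] :
    Ideal.span (Set.range fun i : Fin d => Ideal.Quotient.mk I (x i.succ)) =
      maximalIdeal (R ⧸ I) := by
  rw [← map_maximalIdeal_quotient, ← hx, Ideal.map_span]
  refine le_antisymm (Ideal.span_mono ?_) (Ideal.span_le.2 ?_)
  · rintro _ ⟨i, rfl⟩
    exact ⟨_, ⟨i.succ, rfl⟩, rfl⟩
  · rintro _ ⟨_, ⟨i, rfl⟩, rfl⟩
    refine Fin.cases ?_ (fun j => ?_) i
    · rw [Ideal.Quotient.eq_zero_iff_mem.2 h0]; exact zero_mem _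
    · exact Ideal.subset_span ⟨j, rfl⟩

/-- A regular local ring is a domain. -/
theorem isDomain_of_span_range_eq_maximalIdeal (d : ℕ) : ∀ (R : Type*) [CommRing R] [IsLocalRing R]
    [IsNoetherianRing R] (x : Fin d → R), Ideal.span (Set.range x) = maximalIdeal R →
    (d : WithBot ℕ∞) ≤ ringKrullDim R → IsDomain R := by
  induction d with
  | zero =>
    intro R _ _ _ x hx _
    have : IsField R := isField_iff_maximalIdeal_eq.2 (by rw [← hx]; simp)
    exact this.isDomain
  | succ d ih =>
    intro R _ _ _ x hx hd
    -- q is the bottom of a chain of primes of length d + 1; the aim is q = ⊥.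
    obtain ⟨q, hq, hqd⟩ := exists_isPrime_le_ringKrullDim_quotient hd
    have hx0 : x 0 ∈ maximalIdeal R := hx ▸ Ideal.subset_span ⟨0, rfl⟩
    have hqm : q ≤ maximalIdeal R := le_maximalIdeal hq.ne_top
    have := isLocalRing_quotient hqm
    have hI : Ideal.span {x 0} ≤ maximalIdeal R := (Ideal.span_singleton_le_iff_mem _).2 hx0
    have := isLocalRing_quotient hI
    have hspan := span_range_quotient_head x hx (Ideal.span {x 0})
      (Ideal.mem_span_singleton_self _)
    have hdom : IsDomain (R ⧸ Ideal.span {x 0}) :=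
      ih _ _ hspan (ringKrullDim_le_quotient_singleton hx0 hd)
    have hx0q : x 0 ∉ q := fun h => by
      have h1 := ringKrullDim_le_of_span_range_eq_maximalIdeal _ (span_range_quotient_head x hx q h)
      have h2 := hqd.trans h1
      have h3 : d + 1 ≤ d := by exact_mod_cast h2
      omega
    -- An a ∈ q outside (x₀) is a nonzerodivisor modulo x₀, so dim R/(x₀, a) + 1 ≤ d. But that ring
    -- surjects onto R/(q, x₀), of dimension at least d.
    have hqx : q ≤ Ideal.span {x 0} := by
      intro a ha
      by_contra hax
      set y := Ideal.Quotient.mk q (x 0)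
      have hy : y ∈ maximalIdeal (R ⧸ q) := by
        rw [← map_maximalIdeal_quotient]; exact Ideal.mem_map_of_mem _ hx0
      have h1 := ringKrullDim_le_quotient_singleton hy hqd
      have ha0 : Ideal.Quotient.mk (Ideal.span {x 0}) a ≠ 0 := fun h =>
        hax (Ideal.Quotient.eq_zero_iff_mem.1 h)
      have h2 := ringKrullDim_quotient_succ_le_of_nonZeroDivisor
        (mem_nonZeroDivisors_of_ne_zero ha0)
      let g : R →+* (R ⧸ q) ⧸ Ideal.span {y} :=
        (Ideal.Quotient.mk (Ideal.span {y})).comp (Ideal.Quotient.mk q)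
      have hg : Function.Surjective g :=
        Ideal.Quotient.mk_surjective.comp Ideal.Quotient.mk_surjective
      let g1 : R ⧸ Ideal.span {x 0} →+* (R ⧸ q) ⧸ Ideal.span {y} :=
        Ideal.Quotient.lift _ g (fun b hb => by
          obtain ⟨c, rfl⟩ := Ideal.mem_span_singleton'.1 hb
          rw [map_mul]
          refine mul_eq_zero_of_right _ ?_
          exact Ideal.Quotient.eq_zero_iff_mem.2 (Ideal.mem_span_singleton_self _))
      let g2 : (R ⧸ Ideal.span {x 0}) ⧸ Ideal.span {Ideal.Quotient.mk (Ideal.span {x 0}) a} →+*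
          (R ⧸ q) ⧸ Ideal.span {y} :=
        Ideal.Quotient.lift _ g1 (fun b hb => by
          obtain ⟨c, rfl⟩ := Ideal.mem_span_singleton'.1 hb
          rw [map_mul]
          refine mul_eq_zero_of_right _ ?_
          change Ideal.Quotient.mk _ (Ideal.Quotient.mk q a) = 0
          rw [Ideal.Quotient.eq_zero_iff_mem.2 ha, map_zero])
      have hg2 : Function.Surjective g2 := fun z => by
        obtain ⟨r, rfl⟩ := hg z
        exact ⟨Ideal.Quotient.mk _ (Ideal.Quotient.mk _ r), rfl⟩
      have h3 := ringKrullDim_le_of_surjective g2 hg2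
      have h4 := ringKrullDim_le_of_span_range_eq_maximalIdeal _ hspan
      have h5 : ((d + 1 : ℕ) : WithBot ℕ∞) ≤ d := by
        push_cast
        exact ((add_le_add_left (h1.trans h3) 1).trans h2).trans h4
      have h6 : d + 1 ≤ d := by exact_mod_cast h5
      omega
    -- Primality and x₀ ∉ q turn q ⊆ (x₀) into q = x₀q; Nakayama finishes.
    have hqbot : q = ⊥ := by
      refine Submodule.eq_bot_of_le_smul_of_le_jacobson_bot (maximalIdeal R) q
        (IsNoetherian.noetherian q) ?_ (by rw [jacobson_eq_maximalIdeal _ bot_ne_top])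
      intro a ha
      obtain ⟨b, rfl⟩ := Ideal.mem_span_singleton'.1 (hqx ha)
      have hb : b ∈ q := (hq.mem_or_mem ha).resolve_right hx0q
      rw [mul_comm]
      exact Submodule.smul_mem_smul hx0 hb
    have : (⊥ : Ideal R).IsPrime := hqbot ▸ hq
    exact IsDomain.of_bot_isPrime R

end RegularDomain

/-! ### Quasi-regularity of a regular system of parameters -/

section QuasiRegular

open IsLocalRing MvPolynomial

theorem eval_mem_mul_span_pow {R σ : Type*} [CommRing R] {I : Ideal R} {z : σ → R} {n : ℕ}
    {F : MvPolynomial σ R} (hF : F.IsHomogeneous n) (hI : ∀ α, coeff α F ∈ I) :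
    eval z F ∈ I * Ideal.span (Set.range z) ^ n := by
  rw [F.as_sum, map_sum]
  refine Ideal.sum_mem _ fun α hα => ?_
  have h : (monomial α (coeff α F) : MvPolynomial σ R) = C (coeff α F) * monomial α 1 := by
    rw [C_mul_monomial, mul_one]
  rw [h, map_mul, eval_C]
  refine Ideal.mul_mem_mul (hI α) ?_
  refine (Ideal.mem_span_pow_iff_exists_isHomogeneous z _).2 ⟨_, isHomogeneous_monomial 1 ?_, rfl⟩
  by_contra hne
  exact (mem_support_iff.1 hα) (hF.coeff_eq_zero hne)

/-- Krull's intersection theorem in R/S: ideals of a noetherian local ring are closed. -/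
theorem mem_of_forall_mem_sup_pow {R : Type*} [CommRing R] [IsLocalRing R] [IsNoetherianRing R]
    (S : Ideal R) {z : R} (h : ∀ n, z ∈ S ⊔ maximalIdeal R ^ n) : z ∈ S := by
  rw [← Ideal.Quotient.eq_zero_iff_mem]
  have hbot := Ideal.iInf_pow_smul_eq_bot_of_isLocalRing (M := R ⧸ S) (maximalIdeal R)
    (maximalIdeal.isMaximal R).ne_top
  rw [← Submodule.mem_bot R, ← hbot, Submodule.mem_iInf]
  intro n
  obtain ⟨s, hs, t, ht, rfl⟩ := Submodule.mem_sup.1 (h n)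
  rw [map_add, Ideal.Quotient.eq_zero_iff_mem.2 hs, zero_add]
  have : Ideal.Quotient.mk S t = t • (1 : R ⧸ S) := by
    rw [Algebra.smul_def, mul_one]; rfl
  rw [this]
  exact Submodule.smul_mem_smul ht trivial

theorem sup_pow_succ_le {R : Type*} [CommRing R] (I J : Ideal R) (n : ℕ) :
    (I ⊔ J) ^ (n + 1) ≤ I * (I ⊔ J) ^ n ⊔ J ^ (n + 1) := by
  induction n with
  | zero => simp
  | succ n ih =>
    rw [pow_succ' (I ⊔ J) (n + 1), Ideal.sup_mul]
    refine sup_le le_sup_left ((Ideal.mul_mono_right ih).trans ?_)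
    rw [Ideal.mul_sup, ← pow_succ' J]
    refine sup_le_sup_right ?_ _
    rw [mul_left_comm, pow_succ' (I ⊔ J)]
    exact Ideal.mul_mono_right (Ideal.mul_mono_left le_sup_right)

/-- A family in a local ring is quasi-regular with respect to the maximal ideal if a form of degree
`n` whose value lies in the `n + 1`-st power of the maximal ideal has no unit coefficient. -/
def IsQuasiRegular {R : Type*} [CommRing R] [IsLocalRing R] {d : ℕ} (x : Fin d → R) : Prop :=
  ∀ (n : ℕ) (F : MvPolynomial (Fin d) R), F.IsHomogeneous n →
    eval x F ∈ maximalIdeal R ^ (n + 1) → ∀ α, coeff α F ∈ maximalIdeal R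

/-- Evaluates the splitting F = X₀G + F₀ with F₀ free of X₀; it drives the induction on the degree
of a form. -/
theorem eval_eq_head_mul_add {R : Type*} [CommRing R] {d : ℕ} (x : Fin (d + 1) → R)
    (F : MvPolynomial (Fin (d + 1)) R) :
    eval x F = x 0 * eval x ((finSuccEquiv R d).symm (finSuccEquiv R d F).divX) +
      eval (fun i => x i.succ) ((finSuccEquiv R d F).coeff 0) := by
  have hx : x = Fin.cons (x 0) (fun i => x i.succ) := (Fin.cons_self_tail x).symm
  have key : ∀ G : MvPolynomial (Fin (d + 1)) R, eval x G =
      ((finSuccEquiv R d G).map (eval fun i => x i.succ)).eval (x 0) := fun G => by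
    conv_lhs => rw [hx]
    exact eval_eq_eval_mv_eval' _ _ _
  rw [key F, key, AlgEquiv.apply_symm_apply]
  generalize finSuccEquiv R d F = p
  conv_lhs => rw [← Polynomial.divX_mul_X_add p]
  rw [Polynomial.map_add, Polynomial.map_mul, Polynomial.eval_add, Polynomial.eval_mul,
    Polynomial.map_X, Polynomial.eval_X, Polynomial.map_C, Polynomial.eval_C, mul_comm]

theorem coeff_symm_divX {R : Type*} [CommRing R] {d : ℕ} (F : MvPolynomial (Fin (d + 1)) R)
    (α : Fin (d + 1) →₀ ℕ) :
    coeff α ((finSuccEquiv R d).symm (finSuccEquiv R d F).divX) =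
      coeff (Finsupp.cons (α 0 + 1) α.tail) F := by
  conv_lhs => rw [← Finsupp.cons_tail α]
  rw [← finSuccEquiv_coeff_coeff, AlgEquiv.apply_symm_apply, Polynomial.coeff_divX,
    finSuccEquiv_coeff_coeff]

theorem degree_cons {d : ℕ} (i : ℕ) (α : Fin d →₀ ℕ) :
    (Finsupp.cons i α).degree = i + α.degree := by
  simp [Finsupp.degree_eq_sum, Fin.sum_univ_succ]

theorem isHomogeneous_symm_divX {R : Type*} [CommRing R] {d n : ℕ}
    {F : MvPolynomial (Fin (d + 1)) R} (hF : F.IsHomogeneous (n + 1)) :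
    ((finSuccEquiv R d).symm (finSuccEquiv R d F).divX).IsHomogeneous n := by
  intro α hα
  rw [coeff_symm_divX] at hα
  have h := hF hα
  rw [show Finsupp.weight (1 : Fin (d + 1) → ℕ) = Finsupp.degree from
    (Finsupp.degree_eq_weight_one (R := ℕ)).symm] at h ⊢
  have h' : α.degree = α 0 + α.tail.degree := by
    conv_lhs => rw [← Finsupp.cons_tail α, degree_cons]
  rw [degree_cons] at h
  omega

theorem eval_map_quotient {R σ : Type*} [CommRing R] (I : Ideal R) (z : σ → R)
    (F : MvPolynomial σ R) :
    eval (fun i => Ideal.Quotient.mk I (z i)) (map (Ideal.Quotient.mk I) F) =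
      Ideal.Quotient.mk I (eval z F) :=
  (map_eval (Ideal.Quotient.mk I) z F).symm

theorem mem_maximalIdeal_of_mk_mem {R : Type*} [CommRing R] [IsLocalRing R] {I : Ideal R}
    [IsLocalRing (R ⧸ I)] {c : R} (hc : Ideal.Quotient.mk I c ∈ maximalIdeal (R ⧸ I)) :
    c ∈ maximalIdeal R := by
  rw [mem_maximalIdeal, mem_nonunits_iff] at hc ⊢
  exact fun h => hc (h.map _)

/-- Modulo x₀ the other parameters are quasi-regular. This pushes the part of x₀g outside x₀𝔪ⁿ into
ever higher powers of the ideal J they generate, so x₀g ∈ x₀𝔪ⁿ by Krull, and x₀ cancels. -/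
theorem mem_pow_of_head_mul_mem_pow {R : Type*} [CommRing R] [IsLocalRing R] [IsNoetherianRing R]
    [IsDomain R] {d : ℕ} (x : Fin (d + 1) → R) (hx : Ideal.span (Set.range x) = maximalIdeal R)
    (hx0 : x 0 ≠ 0) [IsLocalRing (R ⧸ Ideal.span {x 0})]
    (hq : IsQuasiRegular fun i : Fin d => Ideal.Quotient.mk (Ideal.span {x 0}) (x i.succ))
    {n : ℕ} {g : R} (hg : x 0 * g ∈ maximalIdeal R ^ (n + 1)) : g ∈ maximalIdeal R ^ n := by
  set I := Ideal.span {x 0} with hI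
  set J := Ideal.span (Set.range fun i : Fin d => x i.succ) with hJ
  have hm : maximalIdeal R = I ⊔ J := by
    rw [← hx, hI, hJ, ← Ideal.span_union]
    congr 1
    ext y
    simp [Fin.exists_fin_succ, eq_comm]
  have hJm : J ≤ maximalIdeal R := hm ▸ le_sup_right
  have hIn : I * maximalIdeal R ^ n ≤ I := Ideal.mul_le_left
  -- A form in the other parameters whose value vanishes modulo x₀ has all its coefficients in 𝔪 = I
  -- + J.
  have hstep : ∀ N, ∀ y ∈ J ^ N, y ∈ I → y ∈ I * J ^ N ⊔ J ^ (N + 1) := by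
    intro N y hy hyI
    obtain ⟨H, hH, rfl⟩ := (Ideal.mem_span_pow_iff_exists_isHomogeneous _ _).1 hy
    have hc : ∀ α, coeff α H ∈ maximalIdeal R := by
      intro α
      have h1 : eval (fun i : Fin d => Ideal.Quotient.mk I (x i.succ))
          (map (Ideal.Quotient.mk I) H) = 0 := by
        rw [eval_map_quotient I (fun i : Fin d => x i.succ)]
        exact Ideal.Quotient.eq_zero_iff_mem.2 hyI
      have h := hq N (map (Ideal.Quotient.mk I) H) (hH.map _) (h1 ▸ zero_mem _) α
      rw [coeff_map] at h
      exact mem_maximalIdeal_of_mk_mem h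
    have h := eval_mem_mul_span_pow (z := fun i : Fin d => x i.succ) hH hc
    rw [hm, Ideal.sup_mul, ← hJ, ← pow_succ'] at h
    exact h
  have hall : ∀ N, n + 1 ≤ N → x 0 * g ∈ I * maximalIdeal R ^ n ⊔ J ^ N := by
    intro N hN
    induction N, hN using Nat.le_induction with
    | base =>
      have := sup_pow_succ_le I J n
      rw [← hm] at this
      exact this hg
    | succ N hN ih =>
      obtain ⟨a, ha, y, hy, hay⟩ := Submodule.mem_sup.1 ih
      have hxI : x 0 * g ∈ I := Ideal.mul_mem_right _ _ (Ideal.mem_span_singleton_self _)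
      have hyI : y ∈ I := by
        have : y = x 0 * g - a := by rw [← hay]; ring
        rw [this]
        exact I.sub_mem hxI (hIn ha)
      rw [← hay]
      refine Ideal.add_mem _ (Submodule.mem_sup_left ha) ?_
      have hle : I * J ^ N ≤ I * maximalIdeal R ^ n := Ideal.mul_mono_right
        ((Ideal.pow_right_mono hJm N).trans (Ideal.pow_le_pow_right (by omega)))
      exact sup_le_sup_right hle (J ^ (N + 1)) (hstep N y hy hyI)
  have hmem : x 0 * g ∈ I * maximalIdeal R ^ n := by
    refine mem_of_forall_mem_sup_pow _ fun N => ?_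
    have hle : J ^ max N (n + 1) ≤ maximalIdeal R ^ N :=
      (Ideal.pow_right_mono hJm _).trans (Ideal.pow_le_pow_right (le_max_left _ _))
    exact sup_le_sup_left hle _ (hall (max N (n + 1)) (le_max_right _ _))
  obtain ⟨a, ha, hxa⟩ := Ideal.mem_span_singleton_mul.1 hmem
  rwa [← mul_left_cancel₀ hx0 hxa]

/-- A regular system of parameters is quasi-regular. -/
theorem isQuasiRegular_of_span_range_eq_maximalIdeal (d : ℕ) : ∀ (R : Type*) [CommRing R]
    [IsLocalRing R] [IsNoetherianRing R] (x : Fin d → R),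
    Ideal.span (Set.range x) = maximalIdeal R → (d : WithBot ℕ∞) ≤ ringKrullDim R →
    IsQuasiRegular x := by
  induction d with
  | zero =>
    intro R _ _ _ x hx _ n F _ hF α
    rw [Subsingleton.elim α 0]
    rw [F.eq_C_of_isEmpty, eval_C] at hF
    exact Ideal.pow_le_self (Nat.succ_ne_zero n) hF
  | succ d ih =>
    intro R _ _ _ x hx hd
    have : IsDomain R := isDomain_of_span_range_eq_maximalIdeal (d + 1) R x hx hd
    have hx0 : x 0 ∈ maximalIdeal R := hx ▸ Ideal.subset_span ⟨0, rfl⟩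
    have hI : Ideal.span {x 0} ≤ maximalIdeal R := (Ideal.span_singleton_le_iff_mem _).2 hx0
    have := isLocalRing_quotient hI
    have hq := ih _ _ (span_range_quotient_head x hx (Ideal.span {x 0})
      (Ideal.mem_span_singleton_self _)) (ringKrullDim_le_quotient_singleton hx0 hd)
    have hx0' : x 0 ≠ 0 := fun h0 => by
      have := isLocalRing_quotient (bot_le : (⊥ : Ideal R) ≤ maximalIdeal R)
      have h1 := ringKrullDim_le_of_span_range_eq_maximalIdeal _
        (span_range_quotient_head x hx ⊥ h0)
      have h2 := hd.trans (ringKrullDim_eq_of_ringEquiv (RingEquiv.quotientBot R) ▸ h1)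
      have h3 : d + 1 ≤ d := by exact_mod_cast h2
      omega
    intro n
    induction n with
    | zero =>
      intro F hF hFx α
      rw [totalDegree_eq_zero_iff_eq_C.1 ((totalDegree_zero_iff_isHomogeneous _).2 hF)] at hFx ⊢
      rw [eval_C, zero_add, pow_one] at hFx
      rw [coeff_C]
      split_ifs
      · exact hFx
      · exact zero_mem _
    | succ n ihn =>
      intro F hF hFx α
      -- Reduction modulo x₀ puts the coefficients of F₀ in 𝔪. Then x₀G(x) has order at least n + 2,
      -- so G(x) has order at least n + 1 and G falls to the induction on degree.
      have hdec := eval_eq_head_mul_add x F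
      set F0 := (finSuccEquiv R d F).coeff 0 with hF0
      set G := (finSuccEquiv R d).symm (finSuccEquiv R d F).divX with hG
      have hF0h : F0.IsHomogeneous (n + 1) :=
        hF.finSuccEquiv_coeff_isHomogeneous 0 (n + 1) (by omega)
      have hGh : G.IsHomogeneous n := isHomogeneous_symm_divX hF
      have h0 : ∀ α, coeff α F0 ∈ maximalIdeal R := fun α => by
        refine mem_maximalIdeal_of_mk_mem (I := Ideal.span {x 0}) ?_
        rw [← coeff_map]
        refine hq (n + 1) _ (hF0h.map _) ?_ α
        rw [eval_map_quotient (Ideal.span {x 0}) (fun i : Fin d => x i.succ),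
          ← map_maximalIdeal_quotient, ← Ideal.map_pow, eq_sub_of_add_eq' hdec.symm, map_sub,
          Ideal.Quotient.eq_zero_iff_mem.2
            (Ideal.mul_mem_right _ _ (Ideal.mem_span_singleton_self _)), sub_zero]
        exact Ideal.mem_map_of_mem _ hFx
      have hF0x := eval_mem_mul_span_pow (z := fun i : Fin d => x i.succ) hF0h h0
      have hF0m : eval (fun i => x i.succ) F0 ∈ maximalIdeal R ^ (n + 1 + 1) := by
        rw [pow_succ' (maximalIdeal R) (n + 1)]
        refine Ideal.mul_mono_right (Ideal.pow_right_mono ?_ _) hF0x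
        rw [← hx]
        exact Ideal.span_mono (Set.range_comp_subset_range Fin.succ x)
      have hGx : eval x G ∈ maximalIdeal R ^ (n + 1) := by
        refine mem_pow_of_head_mul_mem_pow x hx hx0' hq ?_
        rw [eq_sub_of_add_eq hdec.symm]
        exact sub_mem hFx hF0m
      have hGc := ihn G hGh hGx
      rw [← Finsupp.cons_tail α]
      rcases h : α 0 with _ | i
      · rw [← finSuccEquiv_coeff_coeff]
        exact h0 _
      · have := hGc (Finsupp.cons i α.tail)
        rw [coeff_symm_divX] at this
        simpa using this

end QuasiRegular

/-! ### Initial forms and additivity of the order -/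

section InitialForm

open IsLocalRing MvPolynomial

variable {R : Type*} [CommRing R] [IsLocalRing R] {d : ℕ}

open Classical in
/-- The class in degree `n` of an element `b` of the `n`-th power of the maximal ideal, written as a
form of degree `n` in the generators `x` with coefficients in the residue field. -/
noncomputable def initialForm (x : Fin d → R) (n : ℕ) (b : R) :
    MvPolynomial (Fin d) (ResidueField R) :=
  -- The junk value 0 occurs only outside 𝔪ⁿ when x generates 𝔪; independence of the chosen F is
  -- quasi-regularity.
  if h : ∃ F : MvPolynomial (Fin d) R, F.IsHomogeneous n ∧ eval x F = b then
    map (residue R) h.choose else 0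

variable {x : Fin d → R}

theorem initialForm_eval (hq : IsQuasiRegular x) {n : ℕ} {F : MvPolynomial (Fin d) R}
    (hF : F.IsHomogeneous n) : initialForm x n (eval x F) = map (residue R) F := by
  have h : ∃ G : MvPolynomial (Fin d) R, G.IsHomogeneous n ∧ eval x G = eval x F := ⟨F, hF, rfl⟩
  rw [initialForm, dif_pos h]
  obtain ⟨h1, h2⟩ := h.choose_spec
  rw [← sub_eq_zero, ← map_sub]
  ext α
  rw [coeff_map, coeff_zero, residue_eq_zero_iff]
  refine hq n _ (h1.sub hF) ?_ α
  rw [map_sub, h2, sub_self]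
  exact zero_mem _

theorem exists_isHomogeneous_eval_eq (hx : Ideal.span (Set.range x) = maximalIdeal R) {n : ℕ}
    {b : R} (hb : b ∈ maximalIdeal R ^ n) :
    ∃ F : MvPolynomial (Fin d) R, F.IsHomogeneous n ∧ eval x F = b :=
  (Ideal.mem_span_pow_iff_exists_isHomogeneous x b).1 (hx ▸ hb)

theorem initialForm_zero (hq : IsQuasiRegular x) (n : ℕ) : initialForm x n 0 = 0 := by
  have := initialForm_eval hq (isHomogeneous_zero (Fin d) R n)
  simpa using this

theorem initialForm_one (hq : IsQuasiRegular x) : initialForm x 0 1 = 1 := by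
  have := initialForm_eval hq (isHomogeneous_one (Fin d) R)
  simpa using this

variable (hx : Ideal.span (Set.range x) = maximalIdeal R) (hq : IsQuasiRegular x)

include hx hq

theorem initialForm_add {n : ℕ} {a b : R} (ha : a ∈ maximalIdeal R ^ n)
    (hb : b ∈ maximalIdeal R ^ n) :
    initialForm x n (a + b) = initialForm x n a + initialForm x n b := by
  obtain ⟨F, hF, rfl⟩ := exists_isHomogeneous_eval_eq hx ha
  obtain ⟨G, hG, rfl⟩ := exists_isHomogeneous_eval_eq hx hb
  rw [← map_add, initialForm_eval hq (hF.add hG), initialForm_eval hq hF, initialForm_eval hq hG,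
    map_add]

theorem initialForm_mul {m n : ℕ} {a b : R} (ha : a ∈ maximalIdeal R ^ m)
    (hb : b ∈ maximalIdeal R ^ n) :
    initialForm x (m + n) (a * b) = initialForm x m a * initialForm x n b := by
  obtain ⟨F, hF, rfl⟩ := exists_isHomogeneous_eval_eq hx ha
  obtain ⟨G, hG, rfl⟩ := exists_isHomogeneous_eval_eq hx hb
  rw [← map_mul, initialForm_eval hq (hF.mul hG), initialForm_eval hq hF, initialForm_eval hq hG,
    map_mul]

theorem initialForm_pow {n : ℕ} {a : R} (ha : a ∈ maximalIdeal R ^ n) (e : ℕ) :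
    initialForm x (n * e) (a ^ e) = initialForm x n a ^ e := by
  obtain ⟨F, hF, rfl⟩ := exists_isHomogeneous_eval_eq hx ha
  rw [← map_pow, initialForm_eval hq (hF.pow e), initialForm_eval hq hF, map_pow]

theorem initialForm_sum {ι : Type*} (s : Finset ι) {n : ℕ} (a : ι → R)
    (ha : ∀ i ∈ s, a i ∈ maximalIdeal R ^ n) :
    initialForm x n (∑ i ∈ s, a i) = ∑ i ∈ s, initialForm x n (a i) := by
  classical
  induction s using Finset.induction_on with
  | empty => simpa using initialForm_zero hq n
  | insert i s hi ih =>
    have hs : ∀ j ∈ s, a j ∈ maximalIdeal R ^ n := fun j hj => ha j (Finset.mem_insert_of_mem hj)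
    rw [Finset.sum_insert hi, Finset.sum_insert hi,
      initialForm_add hx hq (ha i (Finset.mem_insert_self _ _)) (Ideal.sum_mem _ hs), ih hs]

theorem initialForm_eq_zero_iff {n : ℕ} {b : R} (hb : b ∈ maximalIdeal R ^ n) :
    initialForm x n b = 0 ↔ b ∈ maximalIdeal R ^ (n + 1) := by
  obtain ⟨F, hF, rfl⟩ := exists_isHomogeneous_eval_eq hx hb
  rw [initialForm_eval hq hF]
  have h : map (residue R) F = 0 ↔ ∀ α, coeff α F ∈ maximalIdeal R := by
    rw [MvPolynomial.ext_iff]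
    simp [coeff_map, residue_eq_zero_iff]
  rw [h]
  refine ⟨fun hF' => ?_, fun h' => hq n F hF h'⟩
  have := eval_mem_mul_span_pow (z := x) hF hF'
  rwa [hx, ← pow_succ'] at this

theorem initialForm_ne_zero_iff {n : ℕ} {b : R} (hb : b ∈ maximalIdeal R ^ n) :
    initialForm x n b ≠ 0 ↔ b ∉ maximalIdeal R ^ (n + 1) :=
  (initialForm_eq_zero_iff hx hq hb).not

/-- The graded ring is a polynomial ring over a field, hence a domain, so the initial form of a
product is the product of the initial forms. -/
theorem mul_notMem_pow {m n : ℕ} {a b : R} (ha : a ∈ maximalIdeal R ^ m)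
    (ha' : a ∉ maximalIdeal R ^ (m + 1)) (hb : b ∈ maximalIdeal R ^ n)
    (hb' : b ∉ maximalIdeal R ^ (n + 1)) : a * b ∉ maximalIdeal R ^ (m + n + 1) := by
  have hab : a * b ∈ maximalIdeal R ^ (m + n) := pow_add (maximalIdeal R) m n ▸
    Ideal.mul_mem_mul ha hb
  rw [← initialForm_ne_zero_iff hx hq hab, initialForm_mul hx hq ha hb]
  exact mul_ne_zero ((initialForm_ne_zero_iff hx hq ha).2 ha')
    ((initialForm_ne_zero_iff hx hq hb).2 hb')

omit hx hq in
theorem exists_mem_pow_notMem_pow_succ {m : ℕ} {a : R} (ha : a ∉ maximalIdeal R ^ m) :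
    ∃ n < m, a ∈ maximalIdeal R ^ n ∧ a ∉ maximalIdeal R ^ (n + 1) := by
  induction m with
  | zero => simp at ha
  | succ m ih =>
    by_cases h : a ∈ maximalIdeal R ^ m
    · exact ⟨m, m.lt_succ_self, h, ha⟩
    · obtain ⟨n, hn, h'⟩ := ih h
      exact ⟨n, hn.trans m.lt_succ_self, h'⟩

theorem mem_pow_of_mul_mem_pow {c n : ℕ} {a b : R} (ha : a ∉ maximalIdeal R ^ (c + 1))
    (hab : a * b ∈ maximalIdeal R ^ (c + n)) : b ∈ maximalIdeal R ^ n := by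
  by_contra hb
  obtain ⟨i, hi, h1, h2⟩ := exists_mem_pow_notMem_pow_succ ha
  obtain ⟨j, hj, h3, h4⟩ := exists_mem_pow_notMem_pow_succ hb
  exact mul_notMem_pow hx hq h1 h2 h3 h4 (Ideal.pow_le_pow_right (by omega) hab)

/-- The graded ring is reduced, so the order of a q-th power is exactly q times the order. -/
theorem mem_pow_of_pow_mem_pow {q n : ℕ} {b : R}
    (hb : b ^ q ∈ maximalIdeal R ^ (n * q + 1)) : b ∈ maximalIdeal R ^ (n + 1) := by
  by_contra hb'
  obtain ⟨i, hi, h1, h2⟩ := exists_mem_pow_notMem_pow_succ hb'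
  have h3 : b ^ q ∈ maximalIdeal R ^ (i * q) := by
    rw [pow_mul]; exact Ideal.pow_mem_pow h1 q
  have h4 : b ^ q ∈ maximalIdeal R ^ (i * q + 1) :=
    Ideal.pow_le_pow_right (Nat.succ_le_succ (Nat.mul_le_mul_right q (by omega))) hb
  have h5 := (initialForm_eq_zero_iff hx hq h3).2 h4
  rw [initialForm_pow hx hq h1] at h5
  exact (initialForm_ne_zero_iff hx hq h1).2 h2 (eq_zero_of_pow_eq_zero h5)

end InitialForm

/-! ### Linear order bound from a nonvanishing Jacobian -/

section JacobianBound

open IsLocalRing MvPolynomial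

/-- Vanishing derivatives leave only exponents divisible by p, and perfectness supplies p-th roots
of the coefficients. -/
theorem exists_pow_eq_of_pderiv_eq_zero {k σ : Type*} [Field k] [PerfectField k] (p : ℕ)
    [Fact p.Prime] [CharP k p] {P : MvPolynomial σ k} (hP : ∀ i, pderiv i P = 0) :
    ∃ Q : MvPolynomial σ k, Q ^ p = P := by
  have hdvd : ∀ α ∈ P.support, ∀ i, p ∣ α i := by
    intro α hα i
    rcases h : α i with _ | n
    · exact dvd_zero p
    · have h1 := coeff_pderiv P (i := i) (α - Finsupp.single i 1)
      have h2 : α - Finsupp.single i 1 + Finsupp.single i 1 = α :=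
        tsub_add_cancel_of_le (Finsupp.single_le_iff.2 (by omega))
      have h3 : ((α - Finsupp.single i 1 : σ →₀ ℕ) : σ → ℕ) i = n := by simp [h]
      rw [hP i, coeff_zero, h2, h3] at h1
      have h4 : ((n + 1 : ℕ) : k) = 0 := by
        push_cast
        exact (mul_eq_zero.1 h1.symm).resolve_left (mem_support_iff.1 hα)
      exact (CharP.cast_eq_zero_iff k p _).1 h4
  choose root hroot using fun c : k => exists_pow_eq p 1 c
  refine ⟨∑ α ∈ P.support, monomial (α.mapRange (· / p) (Nat.zero_div p)) (root (coeff α P)), ?_⟩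
  rw [sum_pow_char p]
  conv_rhs => rw [P.as_sum]
  refine Finset.sum_congr rfl fun α hα => ?_
  rw [monomial_pow]
  congr 1
  · congr 1
    ext i
    simpa using Nat.mul_div_cancel' (hdvd α hα i)
  · simpa using hroot (coeff α P)

theorem Derivation.mem_pow_of_mem_pow_succ {k R : Type*} [CommRing k] [CommRing R] [Algebra k R]
    (D : Derivation k R R) (I : Ideal R) {n : ℕ} {b : R} (hb : b ∈ I ^ (n + 1)) : D b ∈ I ^ n := by
  induction n generalizing b with
  | zero => simp
  | succ n ih =>
    rw [pow_succ'] at hb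
    refine Submodule.smul_induction_on hb (fun a ha c hc => ?_) (fun a c ha hc => ?_)
    · rw [smul_eq_mul, D.leibniz, smul_eq_mul, smul_eq_mul]
      refine add_mem ?_ (Ideal.mul_mem_right _ _ hc)
      rw [pow_succ']
      exact Ideal.mul_mem_mul ha (ih hc)
    · rw [map_add]; exact add_mem ha hc

theorem derivation_aeval {k R σ : Type*} [CommRing k] [CommRing R] [Algebra k R] [DecidableEq σ]
    (f : σ → R) (D : Derivation k R R) (i : σ) {h : R} (hD : ∀ j, D (f j) = if i = j then h else 0)
    (P : MvPolynomial σ k) : D (aeval f P) = h * aeval f (pderiv i P) := by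
  induction P using MvPolynomial.induction_on with
  | C a => simp
  | add P Q hP hQ => simp [hP, hQ, mul_add]
  | mul_X P j hP =>
    rw [map_mul, aeval_X, D.leibniz, hP, hD, Derivation.leibniz, pderiv_X]
    by_cases hij : i = j
    · subst hij; simp; ring
    · simp [hij, Ne.symm hij]; ring

theorem totalDegree_pderiv_le {k σ : Type*} [CommRing k] (i : σ) {P : MvPolynomial σ k} {N : ℕ}
    (hP : P.totalDegree ≤ N + 1) : (pderiv i P).totalDegree ≤ N := by
  refine Finset.sup_le fun α hα => ?_
  rw [mem_support_iff, coeff_pderiv] at hα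
  have h := (le_totalDegree (mem_support_iff.2 (left_ne_zero_of_mul hα))).trans hP
  rw [Finsupp.sum_add_index' (fun _ => rfl) (fun _ _ _ => rfl), Finsupp.sum_single_index rfl] at h
  omega

theorem totalDegree_pow_of_isDomain {k σ : Type*} [CommRing k] [IsDomain k] (P : MvPolynomial σ k)
    (n : ℕ) : (P ^ n).totalDegree = n * P.totalDegree := by
  by_cases hP : P = 0
  · rcases n with _ | n <;> simp [hP]
  · induction n with
    | zero => simp
    | succ n ih =>
      rw [pow_succ, totalDegree_mul_of_isDomain (pow_ne_zero n hP) hP, ih]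
      ring

/-- If `f` has a nonvanishing Jacobian of order at most `c`, then the order of the value at `f` of a
nonzero polynomial of degree at most `N` is at most `(c + 1) N`. -/
theorem eq_zero_of_aeval_mem_pow {k R : Type*} [Field k] [PerfectField k] (p : ℕ) [Fact p.Prime]
    [CharP k p] [CommRing R] [IsLocalRing R] [Algebra k R] {d r : ℕ} {x : Fin d → R}
    (hx : Ideal.span (Set.range x) = maximalIdeal R)
    (hq : IsQuasiRegular x) (f : Fin r → R) (D : Fin r → Derivation k R R) {h : R}
    (hD : ∀ i j, D i (f j) = if i = j then h else 0) {c : ℕ} (hc : h ∉ maximalIdeal R ^ (c + 1))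
    (N : ℕ) : ∀ P : MvPolynomial (Fin r) k, P.totalDegree ≤ N →
      aeval f P ∈ maximalIdeal R ^ ((c + 1) * N + 1) → P = 0 := by
  induction N using Nat.strong_induction_on with
  | _ N ih =>
    intro P hP hPf
    rcases N with _ | N
    · rw [totalDegree_eq_zero_iff_eq_C.1 (Nat.le_zero.1 hP)] at hPf ⊢
      by_contra hne
      rw [aeval_C, mul_zero, zero_add, pow_one, mem_maximalIdeal, mem_nonunits_iff] at hPf
      refine hPf (IsUnit.map _ (isUnit_iff_ne_zero.2 fun h0 => hne ?_))
      rw [h0, C_0]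
    · by_cases hall : ∀ i, pderiv i P = 0
      -- Passing from Q^p to Q divides both degree and order by p, so the smaller bound (N + 1)/p
      -- applies to Q.
      · obtain ⟨Q, rfl⟩ := exists_pow_eq_of_pderiv_eq_zero p hall
        have hp : 1 < p := (Fact.out : p.Prime).one_lt
        rw [totalDegree_pow_of_isDomain] at hP
        have hQ : Q.totalDegree ≤ (N + 1) / p := (Nat.le_div_iff_mul_le (by omega)).2
          (by rwa [mul_comm])
        have hlt : (N + 1) / p < N + 1 := Nat.div_lt_self (by omega) hp
        have hQf : aeval f Q ∈ maximalIdeal R ^ ((c + 1) * ((N + 1) / p) + 1) := by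
          refine mem_pow_of_pow_mem_pow hx hq (q := p) ?_
          rw [← map_pow]
          refine Ideal.pow_le_pow_right (Nat.succ_le_succ ?_) hPf
          rw [mul_assoc]
          exact Nat.mul_le_mul_left _ (Nat.div_mul_le_self _ _)
        rw [ih _ hlt Q hQ hQf, zero_pow (by omega)]
      · push Not at hall
        obtain ⟨i, hi⟩ := hall
        refine absurd (ih N N.lt_succ_self (pderiv i P) (totalDegree_pderiv_le i hP) ?_) hi
        -- By the chain rule h · ∂ᵢP(f) = Dᵢ(P(f)). The derivation costs one order and h at most c,
        -- which is the slope c + 1.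
        refine mem_pow_of_mul_mem_pow hx hq hc ?_
        rw [← derivation_aeval f (D i) i (hD i)]
        refine Derivation.mem_pow_of_mem_pow_succ _ _ ?_
        convert hPf using 2
        ring

end JacobianBound

/-! ### Counting dimensions of B/𝔪^M -/

section Growth

open IsLocalRing MvPolynomial

variable {R : Type*} [CommRing R] [IsLocalRing R] {d : ℕ} {x : Fin d → R}

theorem exists_family_span_sup_maximalIdeal (k R : Type*) [Field k] [CommRing R] [IsLocalRing R]
    [Algebra k R] [Module.Finite k (ResidueField R)] :
    ∃ (L : ℕ) (e : Fin L → R), ∀ b : R,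
      ∃ s ∈ Submodule.span k (Set.range e), b - s ∈ maximalIdeal R := by
  obtain ⟨L, v, hv⟩ := Module.Finite.exists_fin (R := k) (M := ResidueField R)
  choose e he using fun i => residue_surjective (v i)
  refine ⟨L, e, fun b => ?_⟩
  have hb : residue R b ∈ Submodule.span k (Set.range v) := hv ▸ Submodule.mem_top
  have hmap : (Submodule.span k (Set.range e)).map
      (IsScalarTower.toAlgHom k R (ResidueField R)).toLinearMap =
      Submodule.span k (Set.range v) := by
    rw [Submodule.map_span, ← Set.range_comp]
    congr 2
    ext i
    exact he i
  rw [← hmap] at hb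
  obtain ⟨s, hs, hsb⟩ := hb
  refine ⟨s, hs, ?_⟩
  rw [← residue_eq_zero_iff, map_sub, sub_eq_zero]
  exact hsb.symm

/-- The length of the quotient by the `M`-th power of the maximal ideal is `O(M ^ d)`, for `d` the
number of generators. -/
theorem exists_finrank_quotient_pow_le (k : Type*) [Field k] [Algebra k R]
    [Module.Finite k (ResidueField R)]
    (hx : Ideal.span (Set.range x) = maximalIdeal R) :
    ∃ L : ℕ, ∀ M : ℕ, Module.Finite k (R ⧸ maximalIdeal R ^ M) ∧
      Module.finrank k (R ⧸ maximalIdeal R ^ M) ≤ L * M ^ d := by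
  obtain ⟨L, e, he⟩ := exists_family_span_sup_maximalIdeal k R
  refine ⟨L, fun M => ?_⟩
  -- The L · M^d products of lifted residue field generators with monomials of all exponents below M
  -- span modulo 𝔪^M: in each degree, coefficients may be changed modulo 𝔪.
  let w : Fin L × (Fin d → Fin M) → R := fun i => e i.1 * ∏ j, x j ^ (i.2 j : ℕ)
  let S : Submodule k R := Submodule.span k (Set.range w)
  let I : ℕ → Submodule k R := fun n => (maximalIdeal R ^ n).restrictScalars k
  have hI : ∀ {n b}, b ∈ I n ↔ b ∈ maximalIdeal R ^ n := Iff.rfl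
  have hstep : ∀ n < M, I n ≤ S ⊔ I (n + 1) := by
    intro n hn b hb
    obtain ⟨F, hF, rfl⟩ := exists_isHomogeneous_eval_eq hx (hI.1 hb)
    rw [eval_eq']
    refine Submodule.sum_mem _ fun α hα => ?_
    have hdeg : α.degree = n := by
      by_contra hne
      exact (mem_support_iff.1 hα) (hF.coeff_eq_zero hne)
    have hlt : ∀ j, α j < M := fun j => by
      have := Finsupp.le_degree j α
      omega
    obtain ⟨s, hs, hbs⟩ := he (coeff α F)
    have hmon : ∏ j, x j ^ α j ∈ maximalIdeal R ^ n := by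
      rw [← hx, Ideal.mem_span_pow_iff_exists_isHomogeneous]
      exact ⟨monomial α 1, isHomogeneous_monomial 1 hdeg, by
        rw [eval_monomial, one_mul, Finsupp.prod_fintype _ _ (fun _ => pow_zero _)]⟩
    rw [show coeff α F * ∏ j, x j ^ α j =
      s * ∏ j, x j ^ α j + (coeff α F - s) * ∏ j, x j ^ α j by ring]
    refine add_mem (Submodule.mem_sup_left ?_) (Submodule.mem_sup_right ?_)
    · have hle : Submodule.span k (Set.range e) ≤
          S.comap (LinearMap.mulRight k (∏ j, x j ^ α j)) := by
        refine Submodule.span_le.2 ?_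
        rintro _ ⟨i, rfl⟩
        exact Submodule.subset_span ⟨(i, fun j => ⟨α j, hlt j⟩), rfl⟩
      exact hle hs
    · rw [hI, pow_succ']
      exact Ideal.mul_mem_mul hbs hmon
  have htop : ∀ n ≤ M, (⊤ : Submodule k R) ≤ S ⊔ I n := by
    intro n hn
    induction n with
    | zero =>
      refine le_sup_of_le_right fun b _ => hI.2 ?_
      rw [pow_zero, Ideal.one_eq_top]
      trivial
    | succ n ih =>
      exact (ih (by omega)).trans (sup_le le_sup_left (hstep n (by omega)))
  let g : R →ₗ[k] R ⧸ maximalIdeal R ^ M := (Ideal.Quotient.mkₐ k _).toLinearMap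
  have hg : Function.Surjective g := Ideal.Quotient.mk_surjective
  have hspan : Submodule.span k (Set.range (g ∘ w)) = ⊤ := by
    rw [Set.range_comp, ← Submodule.map_span, eq_top_iff]
    intro z _
    obtain ⟨b, rfl⟩ := hg z
    obtain ⟨s, hs, t, ht, rfl⟩ := Submodule.mem_sup.1 (htop M le_rfl (Submodule.mem_top (x := b)))
    refine ⟨s, hs, ?_⟩
    have h0 : g t = 0 := Ideal.Quotient.eq_zero_iff_mem.2 (hI.1 ht)
    rw [map_add, h0, add_zero]
  refine ⟨⟨hspan ▸ Submodule.fg_span (Set.finite_range _)⟩, ?_⟩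
  have h := finrank_range_le_card (R := k) (g ∘ w)
  rw [Set.finrank, hspan, finrank_top] at h
  simpa using h

theorem le_of_forall_pow_le {N d L c : ℕ} (h : ∀ n : ℕ, n ^ N ≤ L * (c * n + 1) ^ d) : N ≤ d := by
  by_contra! hlt
  -- One more than the bound that N > d would force on n.
  let n := L * (c + 1) ^ d + 1
  have hn : 1 ≤ n := Nat.le_add_left 1 _
  have h1 : n ^ (d + 1) ≤ L * (c + 1) ^ d * n ^ d := calc
    n ^ (d + 1) ≤ n ^ N := Nat.pow_le_pow_right hn hlt
    _ ≤ L * (c * n + 1) ^ d := h n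
    _ ≤ L * ((c + 1) * n) ^ d := by
      refine Nat.mul_le_mul_left _ (Nat.pow_le_pow_left ?_ _)
      nlinarith
    _ = L * (c + 1) ^ d * n ^ d := by rw [mul_pow, mul_assoc]
  rw [pow_succ'] at h1
  have h2 : n ≤ L * (c + 1) ^ d := Nat.le_of_mul_le_mul_right h1 (by positivity)
  omega

/-- If the order of `P(y)` is bounded by a linear function of the degree of `P ≠ 0`, then the
number of the `y` is at most the number of generators of the maximal ideal. -/
theorem card_le_of_forall_aeval_mem_pow {k : Type*} [Field k] [Algebra k R]
    [Module.Finite k (ResidueField R)] (hx : Ideal.span (Set.range x) = maximalIdeal R)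
    {ι : Type*} [Fintype ι] (y : ι → R) (c : ℕ)
    (h : ∀ (N : ℕ) (P : MvPolynomial ι k), P.totalDegree ≤ N →
      aeval y P ∈ maximalIdeal R ^ (c * N + 1) → P = 0) : Fintype.card ι ≤ d := by
  classical
  obtain ⟨L, hL⟩ := exists_finrank_quotient_pow_le k hx
  -- Test on the n^|ι| monomials with all exponents below n: their span has degree at most |ι|n, so
  -- by h their values stay independent modulo 𝔪^(c|ι|n + 1).
  refine le_of_forall_pow_le (L := L) (c := c * Fintype.card ι) fun n => ?_
  rw [mul_assoc]
  obtain ⟨hfin, hle⟩ := hL (c * (Fintype.card ι * n) + 1)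
  refine le_trans ?_ hle
  let v : (ι → Fin n) → MvPolynomial ι k := fun α =>
    monomial (Finsupp.equivFunOnFinite.symm fun i => (α i : ℕ)) 1
  have hv : LinearIndependent k v := by
    refine (basisMonomials ι k).linearIndependent.comp
      (fun α : ι → Fin n => Finsupp.equivFunOnFinite.symm fun i => (α i : ℕ)) ?_
    intro α β hαβ
    have := Finsupp.equivFunOnFinite.symm.injective hαβ
    funext i
    exact Fin.ext (congrFun this i)
  have hdeg : ∀ P ∈ Submodule.span k (Set.range v), P.totalDegree ≤ Fintype.card ι * n := by
    intro P hP
    rw [← mem_restrictTotalDegree]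
    refine (Submodule.span_le.2 ?_) hP
    rintro _ ⟨α, rfl⟩
    rw [SetLike.mem_coe, mem_restrictTotalDegree]
    refine (totalDegree_monomial_le _ _).trans ?_
    rw [Finsupp.sum_fintype _ _ (fun _ => rfl)]
    refine (Finset.sum_le_card_nsmul _ _ n fun i _ => ?_).trans (by simp)
    exact (α i).2.le
  let g : MvPolynomial ι k →ₐ[k] R ⧸ maximalIdeal R ^ (c * (Fintype.card ι * n) + 1) :=
    (Ideal.Quotient.mkₐ k _).comp (aeval y)
  have hgv : LinearIndependent k (g.toLinearMap ∘ v) := by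
    refine hv.map (Submodule.disjoint_def.2 fun P hP hPg => h _ P (hdeg P hP) ?_)
    exact Ideal.Quotient.eq_zero_iff_mem.1 hPg
  have := hgv.fintype_card_le_finrank
  simpa using this

end Growth

/-! ### The residue field of ν inside Frac(gr B) -/

section ResidueMap

open IsLocalRing MvPolynomial

theorem coe_le_ord_iff {B : Type*} [CommRing B] [IsLocalRing B] {n : ℕ} {b : B} :
    (n : ℕ∞) ≤ ord b ↔ b ∈ maximalIdeal B ^ n := by
  refine ⟨fun h => ?_, fun h => le_iSup₂_of_le n h le_rfl⟩
  by_contra hb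
  obtain ⟨m, hm, h1, h2⟩ := exists_mem_pow_notMem_pow_succ hb
  have hle : ord b ≤ m := by
    refine iSup₂_le fun i hi => ?_
    by_contra hlt
    rw [Nat.cast_le, not_le] at hlt
    exact h2 (Ideal.pow_le_pow_right hlt hi)
  have := h.trans hle
  rw [Nat.cast_le] at this
  omega

theorem ord_eq_coe {B : Type*} [CommRing B] [IsLocalRing B] {n : ℕ} {b : B}
    (h : b ∈ maximalIdeal B ^ n) (h' : b ∉ maximalIdeal B ^ (n + 1)) : ord b = n := by
  refine le_antisymm ?_ (coe_le_ord_iff.2 h)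
  rw [← coe_le_ord_iff, not_le] at h'
  push_cast at h'
  exact Order.le_of_lt_add_one h'

theorem exists_mem_pow_notMem_pow_succ_of_ne_zero {B : Type*} [CommRing B] [IsLocalRing B]
    [IsNoetherianRing B] {b : B} (hb : b ≠ 0) :
    ∃ n, b ∈ maximalIdeal B ^ n ∧ b ∉ maximalIdeal B ^ (n + 1) := by
  have h := Ideal.iInf_pow_eq_bot_of_isLocalRing (maximalIdeal B) (maximalIdeal.isMaximal B).ne_top
  have hb' : ∃ m, b ∉ maximalIdeal B ^ m := by
    by_contra! hall
    exact hb (by rw [← Ideal.mem_bot, ← h, Submodule.mem_iInf]; exact hall)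
  obtain ⟨m, hm⟩ := hb'
  obtain ⟨n, _, h1, h2⟩ := exists_mem_pow_notMem_pow_succ hm
  exact ⟨n, h1, h2⟩

variable {k A B : Type*} [Field k] [CommRing A] [CommRing B] [Algebra k A] [Algebra k B]
  [IsLocalRing B] {d : ℕ} {x : Fin d → B}

theorem initialForm_algebraMap (hq : IsQuasiRegular x) (c : k) :
    initialForm x 0 (algebraMap k B c) =
      algebraMap k (MvPolynomial (Fin d) (ResidueField B)) c := by
  have := initialForm_eval hq (isHomogeneous_C (Fin d) (algebraMap k B c))
  rw [eval_C, map_C] at this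
  rw [this]
  rfl

/-- The field of fractions of the associated graded ring. -/
abbrev FormField (B : Type*) [CommRing B] [IsLocalRing B] (d : ℕ) : Type _ :=
  FractionRing (MvPolynomial (Fin d) (ResidueField B))

/-- The initial form as an element of the field of fractions of the associated graded ring. -/
noncomputable abbrev initialFrac (x : Fin d → B) (n : ℕ) (b : B) : FormField B d :=
  algebraMap (MvPolynomial (Fin d) (ResidueField B)) (FormField B d) (initialForm x n b)

theorem initialFrac_ne_zero (hx : Ideal.span (Set.range x) = maximalIdeal B)
    (hq : IsQuasiRegular x) {n : ℕ} {b : B} (h : b ∈ maximalIdeal B ^ n)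
    (h' : b ∉ maximalIdeal B ^ (n + 1)) : initialFrac x n b ≠ 0 :=
  (map_ne_zero_iff _ (IsFractionRing.injective _ _)).2 ((initialForm_ne_zero_iff hx hq h).2 h')

theorem initialFrac_mul (hx : Ideal.span (Set.range x) = maximalIdeal B)
    (hq : IsQuasiRegular x) {m n : ℕ} {a b : B} (ha : a ∈ maximalIdeal B ^ m)
    (hb : b ∈ maximalIdeal B ^ n) :
    initialFrac x (m + n) (a * b) = initialFrac x m a * initialFrac x n b := by
  rw [← map_mul, ← initialForm_mul hx hq ha hb]

theorem initialFrac_add (hx : Ideal.span (Set.range x) = maximalIdeal B)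
    (hq : IsQuasiRegular x) {n : ℕ} {a b : B} (ha : a ∈ maximalIdeal B ^ n)
    (hb : b ∈ maximalIdeal B ^ n) :
    initialFrac x n (a + b) = initialFrac x n a + initialFrac x n b := by
  rw [← map_add, ← initialForm_add hx hq ha hb]

theorem initialFrac_pow (hx : Ideal.span (Set.range x) = maximalIdeal B)
    (hq : IsQuasiRegular x) {n : ℕ} {a : B} (ha : a ∈ maximalIdeal B ^ n) (e : ℕ) :
    initialFrac x (n * e) (a ^ e) = initialFrac x n a ^ e := by
  rw [← map_pow, ← initialForm_pow hx hq ha]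

variable [IsDomain B]

/-- The graph of the residue map of the valuation ring of the order function. -/
def residueGraph (k : Type*) [Field k] [Algebra k B]
    (hx : Ideal.span (Set.range x) = maximalIdeal B) (hq : IsQuasiRegular x) :
    Subalgebra k (FractionRing B × FormField B d) where
  -- Pairs (a/b, in(a)/in(b)) with b of order exactly n. The numerator is read in degree n, so it
  -- contributes 0 when its order is larger.
  carrier := {z | ∃ (n : ℕ) (a b : B), a ∈ maximalIdeal B ^ n ∧ b ∈ maximalIdeal B ^ n ∧
    b ∉ maximalIdeal B ^ (n + 1) ∧
    z.1 * algebraMap B (FractionRing B) b = algebraMap B (FractionRing B) a ∧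
    z.2 * initialFrac x n b = initialFrac x n a}
  mul_mem' := by
    rintro z w ⟨m, a, b, ha, hb, hb', h1, h2⟩ ⟨n, c, e, hc, he, he', h3, h4⟩
    refine ⟨m + n, a * c, b * e, ?_, ?_, mul_notMem_pow hx hq hb hb' he he', ?_, ?_⟩
    · rw [pow_add]; exact Ideal.mul_mem_mul ha hc
    · rw [pow_add]; exact Ideal.mul_mem_mul hb he
    · rw [map_mul, map_mul, ← h1, ← h3, Prod.fst_mul]; ring
    · rw [initialFrac_mul hx hq hb he, initialFrac_mul hx hq ha hc, ← h2, ← h4, Prod.snd_mul]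
      ring
  add_mem' := by
    rintro z w ⟨m, a, b, ha, hb, hb', h1, h2⟩ ⟨n, c, e, hc, he, he', h3, h4⟩
    have hae : a * e ∈ maximalIdeal B ^ (m + n) := pow_add (maximalIdeal B) m n ▸
      Ideal.mul_mem_mul ha he
    have hbc : b * c ∈ maximalIdeal B ^ (m + n) := pow_add (maximalIdeal B) m n ▸
      Ideal.mul_mem_mul hb hc
    refine ⟨m + n, a * e + b * c, b * e, add_mem hae hbc, ?_, mul_notMem_pow hx hq hb hb' he he',
      ?_, ?_⟩
    · rw [pow_add]; exact Ideal.mul_mem_mul hb he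
    · rw [map_mul, map_add, map_mul, map_mul, ← h1, ← h3, Prod.fst_add]; ring
    · rw [initialFrac_add hx hq hae hbc, initialFrac_mul hx hq hb he,
        initialFrac_mul hx hq ha he, initialFrac_mul hx hq hb hc, ← h2, ← h4, Prod.snd_add]
      ring
  algebraMap_mem' := by
    intro c
    refine ⟨0, algebraMap k B c, 1, by simp, by simp, ?_, ?_, ?_⟩
    · rw [zero_add, pow_one]
      exact fun h => (maximalIdeal.isMaximal B).ne_top ((Ideal.eq_top_iff_one _).2 h)
    · rw [map_one, mul_one, Prod.algebraMap_apply, ← IsScalarTower.algebraMap_apply]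
    · rw [initialFrac, initialFrac, initialForm_one hq, map_one, mul_one,
        initialForm_algebraMap hq, Prod.algebraMap_apply, ← IsScalarTower.algebraMap_apply]

theorem div_mem_residueGraph (k : Type*) [Field k] [Algebra k B]
    (hx : Ideal.span (Set.range x) = maximalIdeal B) (hq : IsQuasiRegular x) {n : ℕ} {a b : B}
    (ha : a ∈ maximalIdeal B ^ n) (hb : b ∈ maximalIdeal B ^ n)
    (hb' : b ∉ maximalIdeal B ^ (n + 1)) :
    (algebraMap B (FractionRing B) a / algebraMap B (FractionRing B) b,
      initialFrac x n a / initialFrac x n b) ∈ residueGraph k hx hq := by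
  refine ⟨n, a, b, ha, hb, hb', div_mul_cancel₀ _ ?_,
    div_mul_cancel₀ _ (initialFrac_ne_zero hx hq hb hb')⟩
  refine (map_ne_zero_iff _ (IsFractionRing.injective B _)).2 ?_
  rintro rfl
  exact hb' (zero_mem _)

omit [IsDomain B] in
-- This is well-definedness of the residue map: a/b = 0 forces a = 0, whose initial form is 0.
theorem residueGraph_fst_injective (k : Type*) [Field k] [Algebra k B]
    (hx : Ideal.span (Set.range x) = maximalIdeal B) (hq : IsQuasiRegular x) :
    Function.Injective ((AlgHom.fst k (FractionRing B) (FormField B d)).comp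
      (residueGraph k hx hq).val) := by
  rw [injective_iff_map_eq_zero]
  rintro ⟨⟨y, z⟩, n, a, b, ha, hb, hb', h1, h2⟩ h
  change y = 0 at h
  subst h
  simp only [zero_mul] at h1 h2
  have ha0 : a = 0 := (map_eq_zero_iff _ (IsFractionRing.injective B (FractionRing B))).1 h1.symm
  rw [ha0, initialFrac, initialFrac, initialForm_zero hq, map_zero] at h2
  have hz : z = 0 := (mul_eq_zero.1 h2).resolve_right (initialFrac_ne_zero hx hq hb hb')
  exact Subtype.ext (Prod.ext rfl hz)

variable [IsNoetherianRing B]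

theorem valRing_le_range (φ : A →ₐ[k] B) (hx : Ideal.span (Set.range x) = maximalIdeal B)
    (hq : IsQuasiRegular x) :
    valRing φ ≤ ((AlgHom.fst k (FractionRing B) (FormField B d)).comp
      (residueGraph k hx hq).val).range := by
  refine Algebra.adjoin_le ?_
  rintro _ ⟨a, b, hb, hab, rfl⟩
  obtain ⟨n, hn, hn'⟩ := exists_mem_pow_notMem_pow_succ_of_ne_zero hb
  rw [ord_eq_coe hn hn', coe_le_ord_iff] at hab
  exact ⟨⟨_, div_mem_residueGraph k hx hq hab hn hn'⟩, rfl⟩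

/-- The residue map of the order function on the valuation ring of `ν`. -/
noncomputable def valResidue (φ : A →ₐ[k] B) (hx : Ideal.span (Set.range x) = maximalIdeal B)
    (hq : IsQuasiRegular x) : valRing φ →ₐ[k] FormField B d :=
  (((AlgHom.snd k (FractionRing B) (FormField B d)).comp (residueGraph k hx hq).val).comp
    (AlgEquiv.ofInjective _ (residueGraph_fst_injective k hx hq)).symm.toAlgHom).comp
    (Subalgebra.inclusion (valRing_le_range φ hx hq))

theorem valResidue_eq (φ : A →ₐ[k] B) (hx : Ideal.span (Set.range x) = maximalIdeal B)
    (hq : IsQuasiRegular x) (v : valRing φ) {y : FormField B d}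
    (h : ((v : FractionRing B), y) ∈ residueGraph k hx hq) : valResidue φ hx hq v = y := by
  have h1 : (AlgEquiv.ofInjective _ (residueGraph_fst_injective k hx hq)).symm
      (Subalgebra.inclusion (valRing_le_range φ hx hq) v) = ⟨(v, y), h⟩ := by
    rw [AlgEquiv.symm_apply_eq]
    rfl
  change ((AlgEquiv.ofInjective _ (residueGraph_fst_injective k hx hq)).symm
      (Subalgebra.inclusion (valRing_le_range φ hx hq) v)).1.2 = y
  rw [h1]

/-- A numerator of order above n has zero initial form in degree n. -/
theorem valIdeal_le_ker (φ : A →ₐ[k] B) (hx : Ideal.span (Set.range x) = maximalIdeal B)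
    (hq : IsQuasiRegular x) : valIdeal φ ≤ RingHom.ker (valResidue φ hx hq) := by
  refine Ideal.span_le.2 ?_
  rintro v ⟨a, b, hb, hab, hv⟩
  obtain ⟨n, hn, hn'⟩ := exists_mem_pow_notMem_pow_succ_of_ne_zero hb
  rw [ord_eq_coe hn hn', ← ENat.add_one_le_iff (ENat.natCast_ne_top n)] at hab
  have ha : φ a ∈ maximalIdeal B ^ (n + 1) := coe_le_ord_iff.1 (by exact_mod_cast hab)
  have ha' := Ideal.pow_le_pow_right n.le_succ ha
  have h := div_mem_residueGraph k hx hq ha' hn hn'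
  rw [← hv] at h
  rw [SetLike.mem_coe, RingHom.mem_ker, valResidue_eq φ hx hq v h, initialFrac,
    (initialForm_eq_zero_iff hx hq ha').2 ha, map_zero, zero_div]

/-- The residue field of `ν` maps onto a subalgebra that contains the quotients of the initial forms
of elements of the same order. -/
theorem exists_subalgebra_trdeg_le (φ : A →ₐ[k] B)
    (hx : Ideal.span (Set.range x) = maximalIdeal B) (hq : IsQuasiRegular x) :
    ∃ S : Subalgebra k (FormField B d),
      Algebra.trdeg k S ≤ Algebra.trdeg k (valRing φ ⧸ valIdeal φ) ∧
      ∀ (n : ℕ) (a b : A), φ a ∈ maximalIdeal B ^ n → φ b ∈ maximalIdeal B ^ n →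
        φ b ∉ maximalIdeal B ^ (n + 1) →
        initialFrac x n (φ a) / initialFrac x n (φ b) ∈ S := by
  -- Only a lower bound on the transcendence degree is needed, so a surjection onto the image
  -- suffices; that the quotient is a field plays no role.
  let g : (valRing φ ⧸ valIdeal φ) →ₐ[k] FormField B d :=
    Ideal.Quotient.liftₐ (valIdeal φ) (valResidue φ hx hq) (valIdeal_le_ker φ hx hq)
  refine ⟨g.range, trdeg_le_of_surjective g.rangeRestrict g.rangeRestrict_surjective, ?_⟩
  intro n a b ha hb hb'
  have hb0 : φ b ≠ 0 := fun h => hb' (h ▸ zero_mem _)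
  let v : valRing φ := ⟨_, Algebra.subset_adjoin
    ⟨a, b, hb0, by rw [ord_eq_coe hb hb']; exact coe_le_ord_iff.2 ha, rfl⟩⟩
  refine ⟨Ideal.Quotient.mk _ v, ?_⟩
  exact valResidue_eq φ hx hq v (div_mem_residueGraph k hx hq ha hb hb')

end ResidueMap

/-! ### Algebraic dependence among initial forms -/

section Transcendence

open IsLocalRing MvPolynomial

theorem natCast_le_trdeg_formField (k : Type*) {B : Type*} [Field k] [CommRing B] [IsLocalRing B]
    [Algebra k B] (d : ℕ) : (d : Cardinal) ≤ Algebra.trdeg k (FormField B d) := by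
  have h1 : AlgebraicIndependent k (X : Fin d → MvPolynomial (Fin d) (ResidueField B)) :=
    (algebraicIndependent_X (Fin d) (ResidueField B)).restrictScalars
      (algebraMap k (ResidueField B)).injective
  have h2 := h1.map' (f := IsScalarTower.toAlgHom k (MvPolynomial (Fin d) (ResidueField B))
    (FormField B d)) (IsFractionRing.injective _ _)
  simpa using h2.lift_cardinalMk_le_trdeg

/-- The variables, as elements of the field of fractions of the associated graded ring. -/
noncomputable abbrev formVar (B : Type*) [CommRing B] [IsLocalRing B] {d : ℕ} (i : Fin d) :
    FormField B d :=
  algebraMap (MvPolynomial (Fin d) (ResidueField B)) (FormField B d) (X i)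

variable {k B : Type*} [Field k] [CommRing B] [IsLocalRing B] [Algebra k B]
  [Module.Finite k (ResidueField B)] {d : ℕ}

theorem isAlgebraic_adjoin_range_formVar (F : Type*) [CommRing F] [IsDomain F] [Algebra k F]
    [Algebra F (FormField B d)] [IsScalarTower k F (FormField B d)] :
    Algebra.IsAlgebraic (Algebra.adjoin F (Set.range (formVar B (d := d)))) (FormField B d) := by
  set T := Algebra.adjoin F (Set.range (formVar B (d := d)))
  have hinj : Function.Injective (algebraMap k T) := FaithfulSMul.algebraMap_injective k T
  have hP : ∀ P : MvPolynomial (Fin d) (ResidueField B),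
      IsAlgebraic T (algebraMap _ (FormField B d) P) := by
    intro P
    induction P using MvPolynomial.induction_on with
    | C a =>
      have h1 : IsAlgebraic k a := IsAlgebraic.of_finite k a
      have h2 : IsAlgebraic k (algebraMap (ResidueField B) (FormField B d) a) := h1.algebraMap
      have h3 := h2.extendScalars hinj
      rwa [IsScalarTower.algebraMap_apply (ResidueField B)
        (MvPolynomial (Fin d) (ResidueField B))] at h3
    | add P Q hP hQ => rw [map_add]; exact hP.add hQ
    | mul_X P i hP =>
      rw [map_mul]
      refine hP.mul ?_
      exact isAlgebraic_algebraMap (⟨_, Algebra.subset_adjoin ⟨i, rfl⟩⟩ : T)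
  refine ⟨fun z => ?_⟩
  obtain ⟨P, Q, _, rfl⟩ := IsFractionRing.div_surjective
    (A := MvPolynomial (Fin d) (ResidueField B)) z
  rw [div_eq_mul_inv]
  exact (hP P).mul (hP Q).inv

/-- The residue field is algebraic over k, so the variables contain a transcendence basis. Taking it
among the variables lets it lift to parameters of B. -/
theorem exists_algebraicIndependent_formVar (k : Type*) [Field k] [Algebra k B]
    [Module.Finite k (ResidueField B)] (F : Type*) [CommRing F] [IsDomain F] [Algebra k F]
    [Algebra F (FormField B d)] [IsScalarTower k F (FormField B d)]
    [FaithfulSMul F (FormField B d)] :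
    ∃ (s : ℕ) (i : Fin s → Fin d), AlgebraicIndependent F (fun j => formVar B (i j)) ∧
      Algebra.trdeg F (FormField B d) = s := by
  have := isAlgebraic_adjoin_range_formVar (k := k) (B := B) (d := d) F
  obtain ⟨t, ht, htb⟩ := exists_isTranscendenceBasis_subset (R := F)
    (Set.range (formVar B (d := d)))
  have hfin : t.Finite := (Set.finite_range _).subset ht
  have : Fintype t := hfin.fintype
  let e := Fintype.equivFin t
  choose i hi using fun u : t => ht u.2
  refine ⟨Fintype.card t, fun j => i (e.symm j), ?_, ?_⟩
  · have := htb.1.comp e.symm e.symm.injective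
    convert this using 2 with j
    exact hi _
  · rw [← htb.cardinalMk_eq_trdeg, Cardinal.mk_fintype]

/-- S[g] is a quotient of a polynomial ring in one variable over S; transcendence degrees add in
towers. -/
theorem trdeg_aeval_range_le {E : Type*} [Field E] [Algebra k E] (S : Subalgebra k E) (g : E) :
    Algebra.trdeg k (Polynomial.aeval g : Polynomial S →ₐ[S] E).range ≤ Algebra.trdeg k S + 1 := by
  have h : Algebra.trdeg S (Polynomial.aeval g : Polynomial S →ₐ[S] E).range ≤ 1 := by
    rw [← Polynomial.trdeg_of_isDomain (R := S)]
    exact trdeg_le_of_surjective _ (AlgHom.rangeRestrict_surjective _)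
  set T := (Polynomial.aeval g : Polynomial S →ₐ[S] E).range
  have : FaithfulSMul S T := (faithfulSMul_iff_algebraMap_injective _ _).2 fun a b hab =>
    Subtype.ext (congrArg (Subtype.val : T → E) hab)
  rw [← trdeg_add_eq k S]
  gcongr

omit [Module.Finite k (ResidueField B)] in
/-- Elements whose power lies in the image of `φ` have initial forms that are algebraic over the
quotients of initial forms together with one initial form of positive degree. -/
theorem isAlgebraic_initialFrac {A : Type*} [CommRing A] [Algebra k A] {x : Fin d → B}
    (hx : Ideal.span (Set.range x) = maximalIdeal B) (hq : IsQuasiRegular x) (φ : A →ₐ[k] B)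
    (S : Subalgebra k (FormField B d))
    (hS : ∀ (n : ℕ) (a b : A), φ a ∈ maximalIdeal B ^ n → φ b ∈ maximalIdeal B ^ n →
        φ b ∉ maximalIdeal B ^ (n + 1) →
        initialFrac x n (φ a) / initialFrac x n (φ b) ∈ S)
    {a₀ : A} {e : ℕ} (he : 0 < e) (h₀ : φ a₀ ∈ maximalIdeal B ^ e)
    (h₀' : φ a₀ ∉ maximalIdeal B ^ (e + 1)) {a : A} {c : B} {q n : ℕ} (hq0 : 0 < q)
    (hc : c ^ q = φ a) (hcn : c ∈ maximalIdeal B ^ n) :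
    IsAlgebraic (Polynomial.aeval (initialFrac x e (φ a₀)) :
      Polynomial S →ₐ[S] FormField B d).range (initialFrac x n c) := by
  set A₁ := (Polynomial.aeval (initialFrac x e (φ a₀)) : Polynomial S →ₐ[S] FormField B d).range
  have hg : initialFrac x e (φ a₀) ∈ A₁ := ⟨Polynomial.X, Polynomial.aeval_X _⟩
  have hne := initialFrac_ne_zero hx hq h₀ h₀'
  -- The exponents equalize degrees: φ(a₀)^(nq) has order exactly enq and φ(a)^e = c^(qe) order at
  -- least enq. So in(c)^(qe) / g^(nq) lies in S, where g = in(φ(a₀)).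
  have hpow : φ (a₀ ^ (n * q)) ∈ maximalIdeal B ^ (e * (n * q)) := by
    rw [map_pow, pow_mul]; exact Ideal.pow_mem_pow h₀ _
  have hform : initialFrac x (e * (n * q)) (φ (a₀ ^ (n * q))) =
      initialFrac x e (φ a₀) ^ (n * q) := by
    rw [map_pow]; exact initialFrac_pow hx hq h₀ _
  have hpow' : φ (a₀ ^ (n * q)) ∉ maximalIdeal B ^ (e * (n * q) + 1) := by
    rw [← initialForm_ne_zero_iff hx hq hpow]
    intro h
    rw [initialFrac, h, map_zero] at hform
    exact pow_ne_zero _ hne hform.symm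
  have hca : φ (a ^ e) ∈ maximalIdeal B ^ (e * (n * q)) := by
    rw [map_pow, ← hc, mul_comm, pow_mul, pow_mul]
    exact Ideal.pow_mem_pow (Ideal.pow_mem_pow hcn _) _
  have hcform : initialFrac x (e * (n * q)) (φ (a ^ e)) = initialFrac x n c ^ (q * e) := by
    rw [← initialFrac_pow hx hq hcn, map_pow, ← hc, ← pow_mul,
      show e * (n * q) = n * (q * e) by ring]
  have hu := hS _ _ _ hca hpow hpow'
  rw [hform, hcform] at hu
  refine IsAlgebraic.of_pow (n := q * e) (by positivity) ?_
  have hmem : initialFrac x n c ^ (q * e) ∈ A₁ := by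
    rw [← div_mul_cancel₀ (initialFrac x n c ^ (q * e)) (pow_ne_zero (n * q) hne)]
    exact mul_mem (A₁.algebraMap_mem ⟨_, hu⟩) (pow_mem hg _)
  exact isAlgebraic_algebraMap (⟨_, hmem⟩ : A₁)

omit [Module.Finite k (ResidueField B)] [Algebra k B] in
theorem initialFrac_prod_pow {x : Fin d → B} (hq : IsQuasiRegular x) {s : ℕ} (i : Fin s → Fin d)
    (α : Fin s →₀ ℕ) :
    initialFrac x α.degree (∏ j, x (i j) ^ α j) = ∏ j, formVar B (i j) ^ α j := by
  have hF : (∏ j, (X (i j) : MvPolynomial (Fin d) B) ^ α j).IsHomogeneous α.degree := by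
    rw [Finsupp.degree_eq_sum]
    exact IsHomogeneous.prod _ _ _ fun j _ => isHomogeneous_X_pow _ _
  have h := initialForm_eval hq hF
  simp only [map_prod, map_pow, eval_X, map_X] at h
  rw [initialFrac, h, map_prod]
  simp only [map_pow]

/-- Let the variables `i` be algebraically independent over a ring over which the initial forms of
the coefficients of `v` are algebraic. Then the order of `v(x)` is the minimal order of its terms. -/
theorem coeff_mem_pow_of_eval_mem_pow {x : Fin d → B}
    (hx : Ideal.span (Set.range x) = maximalIdeal B) (hq : IsQuasiRegular x)
    {F : Type*} [CommRing F] [IsDomain F] [Algebra F (FormField B d)] {s : ℕ} {i : Fin s → Fin d}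
    (hi : AlgebraicIndependent F (fun j => formVar B (i j))) (v : MvPolynomial (Fin s) B)
    (hv : ∀ α n, coeff α v ∈ maximalIdeal B ^ n → IsAlgebraic F (initialFrac x n (coeff α v)))
    (J : ℕ) (hJ : eval (fun j => x (i j)) v ∈ maximalIdeal B ^ J) (α : Fin s →₀ ℕ) :
    coeff α v ∈ maximalIdeal B ^ (J - α.degree) := by
  classical
  induction J generalizing α with
  | zero => simp
  | succ J ih =>
    -- All terms now lie in 𝔪^J, and their degree J parts sum to zero. This is a polynomial relation
    -- among independent variables, so each coefficient vanishes and its term gains one order.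
    have ih' := ih (Ideal.pow_le_pow_right J.le_succ hJ)
    have hmon : ∀ α : Fin s →₀ ℕ, ∏ j, x (i j) ^ α j ∈ maximalIdeal B ^ α.degree := by
      intro α
      rw [Finsupp.degree_eq_sum, ← Finset.prod_pow_eq_pow_sum]
      exact Ideal.prod_mem_prod fun j _ => Ideal.pow_mem_pow (hx ▸ Ideal.subset_span ⟨_, rfl⟩) _
    have hterm : ∀ α : Fin s →₀ ℕ, coeff α v * ∏ j, x (i j) ^ α j ∈
        maximalIdeal B ^ (J - α.degree + α.degree) := fun α => by
      rw [pow_add]; exact Ideal.mul_mem_mul (ih' α) (hmon α)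
    have hterm' : ∀ α : Fin s →₀ ℕ, coeff α v * ∏ j, x (i j) ^ α j ∈ maximalIdeal B ^ J :=
      fun α => Ideal.pow_le_pow_right (by omega) (hterm α)
    -- The initial forms of the coefficients lie in this algebraic closure, and independence
    -- persists over it.
    let K := Subalgebra.algebraicClosure F (FormField B d)
    have hK : AlgebraicIndependent K (fun j => formVar B (i j)) := hi.subalgebraAlgebraicClosure
    -- For |α| > J the monomial alone is in 𝔪^(J + 1), hence the value 0; this also avoids truncated
    -- subtraction.
    let c : (Fin s →₀ ℕ) → K := fun α =>
      if α.degree ≤ J then ⟨initialFrac x (J - α.degree) (coeff α v), hv α _ (ih' α)⟩ else 0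
    let w : MvPolynomial (Fin s) K := ∑ α ∈ v.support, monomial α (c α)
    have hform : ∀ α : Fin s →₀ ℕ, initialFrac x J (coeff α v * ∏ j, x (i j) ^ α j) =
        (c α : FormField B d) * ∏ j, formVar B (i j) ^ α j := by
      intro α
      by_cases hα : α.degree ≤ J
      · rw [← initialFrac_prod_pow hq, show (c α : FormField B d) =
          initialFrac x (J - α.degree) (coeff α v) by simp only [c, if_pos hα],
          ← initialFrac_mul hx hq (ih' α) (hmon α), Nat.sub_add_cancel hα]
      · have h1 : coeff α v * ∏ j, x (i j) ^ α j ∈ maximalIdeal B ^ (J + 1) :=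
          Ideal.pow_le_pow_right (by omega) (hterm α)
        rw [initialFrac, (initialForm_eq_zero_iff hx hq (hterm' α)).2 h1, map_zero]
        simp only [c, if_neg hα]
        simp
    have hw : aeval (fun j => formVar B (i j)) w = 0 := by
      have h1 : initialFrac x J (eval (fun j => x (i j)) v) = 0 := by
        rw [initialFrac, (initialForm_eq_zero_iff hx hq
          (Ideal.pow_le_pow_right J.le_succ hJ)).2 hJ, map_zero]
      rw [eval_eq', initialFrac, initialForm_sum hx hq _ _ (fun α _ => hterm' α), map_sum] at h1
      rw [← h1, map_sum]
      refine Finset.sum_congr rfl fun α _ => ?_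
      refine Eq.trans ?_ (hform α).symm
      rw [aeval_monomial, Finsupp.prod_fintype _ _ (fun _ => pow_zero _)]
      rfl
    have hw0 : w = 0 := (map_eq_zero_iff _ hK).1 hw
    by_cases hα : α.degree ≤ J
    · by_cases hs : α ∈ v.support
      · have h1 : c α = 0 := by
          have h2 : coeff α w = c α := by
            simp only [w, coeff_sum, coeff_monomial]
            rw [Finset.sum_ite_eq' v.support α c, if_pos hs]
          rw [← h2, hw0, coeff_zero]
        have h3 : initialFrac x (J - α.degree) (coeff α v) = 0 := by
          have := congrArg (Subtype.val) h1
          simp only [c, if_pos hα] at this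
          exact this
        rw [initialFrac, map_eq_zero_iff _ (IsFractionRing.injective _ _),
          initialForm_eq_zero_iff hx hq (ih' α)] at h3
        rwa [Nat.sub_add_comm hα]
      · rw [notMem_support_iff.1 hs]; exact zero_mem _
    · rw [show J + 1 - α.degree = 0 by omega]; simp

end Transcendence

/-! ### The Jacobian family is bounded by the geometric rank -/

section Comparison

open IsLocalRing MvPolynomial

theorem sumAlgEquiv_monomial {k σ τ : Type*} [CommRing k] (α : σ →₀ ℕ) (β : τ →₀ ℕ) (a : k) :
    sumAlgEquiv k σ τ (monomial (α.sumElim β) a) = monomial α (monomial β a) := by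
  have h : (monomial (α.sumElim β) a : MvPolynomial (σ ⊕ τ) k) =
      rename Sum.inl (monomial α 1) * rename Sum.inr (monomial β a) := by
    rw [rename_monomial, rename_monomial, monomial_mul, one_mul, Finsupp.sumElim_eq_add]
  have h1 : sumAlgEquiv k σ τ (rename Sum.inl (monomial α 1)) = monomial α 1 := by
    have := DFunLike.congr_fun (sumAlgEquiv_comp_rename_inl k σ τ) (monomial α 1)
    refine this.trans ?_
    simp [map_monomial]
  have h2 : sumAlgEquiv k σ τ (rename Sum.inr (monomial β a)) = C (monomial β a) :=
    DFunLike.congr_fun (sumAlgEquiv_comp_rename_inr k σ τ) (monomial β a)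
  rw [h, map_mul, h1, h2, mul_comm, C_mul_monomial, mul_one]

/-- Each monomial splits into its two blocks of variables, and the block degrees add up to at most
N. -/
theorem totalDegree_coeff_sumAlgEquiv_le {k σ τ : Type*} [CommRing k] {N : ℕ}
    {P : MvPolynomial (σ ⊕ τ) k} (hP : P.totalDegree ≤ N) (α : σ →₀ ℕ) :
    (coeff α (sumAlgEquiv k σ τ P)).totalDegree ≤ N ∧
      (coeff α (sumAlgEquiv k σ τ P) ≠ 0 → α.degree ≤ N) := by
  classical
  let l : (σ ⊕ τ →₀ ℕ) → σ →₀ ℕ := fun γ => γ.comapDomain Sum.inl Sum.inl_injective.injOn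
  let m : (σ ⊕ τ →₀ ℕ) → τ →₀ ℕ := fun γ => γ.comapDomain Sum.inr Sum.inr_injective.injOn
  have hlm : ∀ γ, (l γ).sumElim (m γ) = γ := Finsupp.comapDomain_sumElim_comapDomain
  have hdeg : ∀ γ ∈ P.support, (l γ).degree + (m γ).degree ≤ N := by
    intro γ hγ
    refine le_trans (le_of_eq ?_) ((le_totalDegree hγ).trans hP)
    conv_rhs => rw [← hlm γ]
    exact (Finsupp.sum_sumElim (l γ) (m γ) (fun _ e => e)).symm
  have hsum : coeff α (sumAlgEquiv k σ τ P) =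
      ∑ γ ∈ P.support, if l γ = α then monomial (m γ) (coeff γ P) else 0 := by
    conv_lhs => rw [P.as_sum]
    rw [map_sum, coeff_sum]
    refine Finset.sum_congr rfl fun γ _ => ?_
    conv_lhs => rw [← hlm γ, sumAlgEquiv_monomial, coeff_monomial, hlm γ]
  rw [hsum]
  refine ⟨totalDegree_finsetSum_le fun γ hγ => ?_, fun h => ?_⟩
  · split_ifs
    · refine (totalDegree_monomial_le _ _).trans ?_
      exact (Nat.le_add_left _ _).trans (hdeg γ hγ)
    · simp
  · obtain ⟨γ, hγ, hne⟩ := Finset.exists_ne_zero_of_sum_ne_zero h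
    have hα : l γ = α := by
      by_contra hα
      exact hne (if_neg hα)
    exact hα ▸ (Nat.le_add_right _ _).trans (hdeg γ hγ)

theorem eval_map_aeval_sumAlgEquiv {k R σ τ : Type*} [CommRing k] [CommRing R] [Algebra k R]
    (z : σ → R) (f : τ → R) (P : MvPolynomial (σ ⊕ τ) k) :
    eval z (map (aeval f : MvPolynomial τ k →ₐ[k] R).toRingHom (sumAlgEquiv k σ τ P)) =
      aeval (Sum.elim z f) P := by
  induction P using MvPolynomial.induction_on with
  | C a => simp
  | add P Q hP hQ => simp only [map_add, hP, hQ]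
  | mul_X P i hP =>
    rw [map_mul, map_mul, map_mul, hP, map_mul]
    rcases i with i | i <;> simp

variable {k A B : Type*} [Field k] [PerfectField k] [CommRing A] [CommRing B]
  [IsDomain B] [IsLocalRing B] [IsNoetherianRing B] [Algebra k A] [Algebra k B]
  [Module.Finite k (ResidueField B)]

omit [PerfectField k] [IsDomain B] [IsNoetherianRing B]
  [Module.Finite k (ResidueField B)] in
-- By additivity of Frobenius, the elements whose pⁿ-th power lies in φ(A) form a k-subalgebra.
theorem exists_aeval_pow_eq (p : ℕ) [Fact p.Prime] [CharP k p] (φ : A →ₐ[k] B) (n : ℕ) {σ : Type*}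
    (f : σ → B) (hf : ∀ i, ∃ a : A, f i ^ p ^ n = φ a) (P : MvPolynomial σ k) :
    ∃ a : A, (aeval f P) ^ p ^ n = φ a := by
  have : CharP B p := charP_of_algebra k p
  induction P using MvPolynomial.induction_on with
  | C c => exact ⟨algebraMap k A (c ^ p ^ n), by rw [aeval_C, φ.commutes, map_pow]⟩
  | add P Q hP hQ =>
    obtain ⟨a, ha⟩ := hP
    obtain ⟨b, hb⟩ := hQ
    exact ⟨a + b, by rw [map_add, add_pow_char_pow, ha, hb, map_add]⟩
  | mul_X P i hP =>
    obtain ⟨a, ha⟩ := hP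
    obtain ⟨b, hb⟩ := hf i
    exact ⟨a * b, by rw [map_mul, aeval_X, mul_pow, ha, hb, map_mul]⟩

/-- If `f` is a family of `r` elements with a nonvanishing Jacobian, and powers of the `f` lie in
the image of `φ`, then `r` is at most the geometric rank of `φ`. -/
theorem natCast_le_grk [IsLocalRing A] (p : ℕ) [Fact p.Prime] [CharP k p] (φ : A →ₐ[k] B)
    [IsLocalHom φ] [Module.Finite k (ResidueField A)] {d : ℕ} {x : Fin d → B}
    (hx : Ideal.span (Set.range x) = maximalIdeal B) (hq : IsQuasiRegular x) {r : ℕ}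
    (f : Fin r → B) (n : ℕ) (hf : ∀ i, ∃ a : A, f i ^ p ^ n = φ a) (D : Fin r → Derivation k B B)
    {h : B} (h0 : h ≠ 0) (hD : ∀ i j, D i (f j) = if i = j then h else 0) :
    (r : Cardinal) ≤ grk φ := by
  classical
  rcases Nat.eq_zero_or_pos r with rfl | hr
  · simp
  obtain ⟨c, -, hc⟩ := exists_mem_pow_notMem_pow_succ_of_ne_zero h0
  have hlow : ∀ (N : ℕ) (P : MvPolynomial (Fin r) k), P.totalDegree ≤ N →
      aeval f P ∈ maximalIdeal B ^ ((c + 1) * N + 1) → P = 0 :=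
    eq_zero_of_aeval_mem_pow p hx hq f D hD hc
  have hinj : Function.Injective (aeval f : MvPolynomial (Fin r) k →ₐ[k] B) := by
    rw [injective_iff_map_eq_zero]
    intro P hP
    exact hlow _ P le_rfl (hP ▸ zero_mem _)
  have hpn : 0 < p ^ n := pow_pos (Fact.out : p.Prime).pos n
  -- If φ killed the maximal ideal of A, then φ(A) would be algebraic over k, while a power of the
  -- transcendental element f₀ lies in it.
  have hnontriv : ∃ a ∈ maximalIdeal A, φ a ≠ 0 := by
    by_contra! hall
    obtain ⟨a, ha⟩ := hf ⟨0, hr⟩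
    obtain ⟨Q, hQ0, hQ⟩ := IsAlgebraic.of_finite k (residue A a)
    have h1 : Polynomial.aeval (residue A a) Q = residue A (Polynomial.aeval a Q) :=
      Polynomial.aeval_algHom_apply (IsScalarTower.toAlgHom k A (ResidueField A)) a Q
    rw [h1, residue_eq_zero_iff] at hQ
    have h2 := hall _ hQ
    rw [← Polynomial.aeval_algHom_apply, ← ha, ← aeval_X (R := k) f, ← map_pow,
      Polynomial.aeval_algHom_apply, map_eq_zero_iff _ hinj] at h2
    have h3 : Transcendental k ((X ⟨0, hr⟩ : MvPolynomial (Fin r) k) ^ p ^ n) :=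
      (transcendental_X k _).pow hpn
    exact h3 ⟨Q, hQ0, h2⟩
  rw [grk, if_pos hnontriv]
  obtain ⟨a₀, ha₀, hφ⟩ := hnontriv
  obtain ⟨e, he, he'⟩ := exists_mem_pow_notMem_pow_succ_of_ne_zero hφ
  have hepos : 0 < e := by
    rcases Nat.eq_zero_or_pos e with rfl | h
    · refine absurd ?_ he'
      rw [zero_add, pow_one]
      rw [mem_maximalIdeal, mem_nonunits_iff] at ha₀ ⊢
      exact fun hu => ha₀ (IsUnit.of_map φ a₀ hu)
    · exact h
  obtain ⟨S, hStr, hS⟩ := exists_subalgebra_trdeg_le φ hx hq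
  let A₁ := (Polynomial.aeval (initialFrac x e (φ a₀)) : Polynomial S →ₐ[S] FormField B d).range
  obtain ⟨s, i, hi, his⟩ := exists_algebraicIndependent_formVar k (B := B) (d := d) A₁
  have hcard : r + s ≤ d := by
    let y : Fin s ⊕ Fin r → B := Sum.elim (fun j => x (i j)) f
    -- The slope is c + 1 for the coefficients P_α(f), plus 1 for the monomials x^α with |α| ≤ N.
    have := card_le_of_forall_aeval_mem_pow (k := k) hx y (c + 2) ?_
    · simpa [add_comm] using this
    intro N P hP hPy
    let P' := sumAlgEquiv k (Fin s) (Fin r) P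
    let v : MvPolynomial (Fin s) B := map (aeval f : MvPolynomial (Fin r) k →ₐ[k] B).toRingHom P'
    have hvy : eval (fun j => x (i j)) v = aeval y P :=
      eval_map_aeval_sumAlgEquiv _ f P
    have hcoeff : ∀ α, coeff α v = aeval f (coeff α P') := fun α => coeff_map _ _ _
    have hmem := coeff_mem_pow_of_eval_mem_pow hx hq hi v (fun α m hm => by
      rw [hcoeff] at hm ⊢
      obtain ⟨a, ha⟩ := exists_aeval_pow_eq p φ n f hf (coeff α P')
      exact isAlgebraic_initialFrac hx hq φ S hS hepos he he' hpn ha hm) _ (hvy ▸ hPy)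
    have hP' : P' = 0 := by
      ext1 α
      rw [coeff_zero]
      by_contra hne
      obtain ⟨h1, h2⟩ := totalDegree_coeff_sumAlgEquiv_le hP α
      have h3 := h2 hne
      refine hne (hlow N _ h1 ?_)
      rw [← hcoeff]
      refine Ideal.pow_le_pow_right ?_ (hmem α)
      have : (c + 2) * N = (c + 1) * N + N := by ring
      omega
    exact (map_eq_zero_iff _ (sumAlgEquiv k (Fin s) (Fin r)).injective).1 hP'
  have h1 : (d : Cardinal) ≤ Algebra.trdeg k A₁ + s := by
    rw [← his, trdeg_add_eq k A₁]
    exact natCast_le_trdeg_formField k d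
  have h2 : Algebra.trdeg k A₁ ≤ Algebra.trdeg k (valRing φ ⧸ valIdeal φ) + 1 :=
    (trdeg_aeval_range_le S _).trans (by gcongr)
  have h3 : (r : Cardinal) + s ≤ Algebra.trdeg k (valRing φ ⧸ valIdeal φ) + 1 + s := calc
    (r : Cardinal) + s ≤ d := by exact_mod_cast hcard
    _ ≤ Algebra.trdeg k A₁ + s := h1
    _ ≤ _ := by gcongr
  -- Cancelling s is legitimate because s is finite, even if the other summand is not.
  exact (Cardinal.add_le_add_iff_of_lt_aleph0 (Cardinal.natCast_lt_aleph0)).1 h3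

end Comparison

/-! ### Independent generators and dual functionals -/

section DualFamily

open IsLocalRing

/-- After localization a spanning set contains a basis, so the independent vectors can be taken in s
itself: for differentials, exact ones. -/
theorem exists_linearIndependent_mem_of_le_finrank_span {R M : Type*} [CommRing R] [IsDomain R]
    [AddCommGroup M] [Module R M] [Module.Finite R M] (s : Set M) {r : ℕ}
    (hr : r ≤ Module.finrank R (Submodule.span R s)) :
    ∃ v : Fin r → M, (∀ i, v i ∈ s) ∧ LinearIndependent (FractionRing R)
      (LocalizedModule.mkLinearMap (nonZeroDivisors R) M ∘ v) := by
  let K := FractionRing R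
  let μ := LocalizedModule.mkLinearMap (nonZeroDivisors R) M
  have hfin : Module.Finite K (LocalizedModule (nonZeroDivisors R) M) :=
    Module.Finite.of_isLocalizedModule (nonZeroDivisors R) μ
  obtain ⟨w, hw⟩ := exists_linearIndependent_of_le_finrank hr
  have hw' : LinearIndependent R (fun i => (w i : M)) :=
    hw.map' (Submodule.span R s).subtype (Submodule.ker_subtype _)
  have hμw : LinearIndependent K (μ ∘ fun i => (w i : M)) :=
    hw'.of_isLocalizedModule K (nonZeroDivisors R) μ
  obtain ⟨t, hts, htspan, ht⟩ := exists_linearIndependent K (μ '' s)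
  have htfin : t.Finite := ht.setFinite
  have := htfin.fintype
  have hmem : ∀ m ∈ Submodule.span R s, μ m ∈ Submodule.span K t := by
    intro m hm
    rw [htspan]
    have hle : Submodule.span R s ≤
        ((Submodule.span K (μ '' s)).restrictScalars R).comap μ :=
      Submodule.span_le.2 fun a ha => Submodule.subset_span ⟨a, ha, rfl⟩
    exact hle hm
  have hcard : r ≤ Fintype.card t := by
    have h1 : LinearIndependent K (fun i => (⟨μ (w i), hmem _ (w i).2⟩ : Submodule.span K t)) :=
      LinearIndependent.of_comp (Submodule.span K t).subtype hμw
    have h2 := h1.fintype_card_le_finrank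
    rw [Fintype.card_fin, finrank_span_set_eq_card ht, Set.toFinset_card] at h2
    exact h2
  have e : Fin r ↪ t := (Function.Embedding.nonempty_of_card_le (by simpa using hcard)).some
  choose v hv hve using fun i => hts (e i).2
  refine ⟨v, hv, ?_⟩
  have heq : μ ∘ v = Subtype.val ∘ e := funext hve
  change LinearIndependent K (μ ∘ v)
  rw [heq]
  exact ht.comp e e.injective

/-- A family in a finite module over a domain that is linearly independent over the field of
fractions has a dual family up to a nonzero factor. -/
theorem exists_dual_family {R M : Type*} [CommRing R] [IsDomain R] [AddCommGroup M] [Module R M]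
    [Module.Finite R M] {r : ℕ} (v : Fin r → M) (hv : LinearIndependent (FractionRing R)
      (LocalizedModule.mkLinearMap (nonZeroDivisors R) M ∘ v)) :
    ∃ (l : Fin r → M →ₗ[R] R) (h : R), h ≠ 0 ∧ ∀ i j, l i (v j) = if i = j then h else 0 := by
  let K := FractionRing R
  let μ := LocalizedModule.mkLinearMap (nonZeroDivisors R) M
  -- Coordinate functionals on the span, extended to the whole vector space.
  have hdual : ∀ i, ∃ g : LocalizedModule (nonZeroDivisors R) M →ₗ[K] K,
      ∀ j, g (μ (v j)) = if i = j then 1 else 0 := by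
    intro i
    obtain ⟨g, hg⟩ := LinearMap.exists_extend ((Finsupp.lapply i).comp hv.repr)
    refine ⟨g, fun j => ?_⟩
    have h1 := LinearMap.congr_fun hg
      (⟨μ (v j), Submodule.subset_span ⟨j, rfl⟩⟩ : Submodule.span K (Set.range (μ ∘ v)))
    refine h1.trans ?_
    change hv.repr _ i = _
    rw [hv.repr_eq_single j _ rfl, Finsupp.single_apply]
    simp only [eq_comm]
  choose g hg using hdual
  obtain ⟨q, m, hm⟩ := Module.Finite.exists_fin (R := R) (M := M)
  -- A common denominator of the values on finitely many generators of M; it becomes h.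
  obtain ⟨b, hb⟩ := IsLocalization.exist_integer_multiples_of_finite (nonZeroDivisors R)
    (fun ij : Fin r × Fin q => g ij.1 (μ (m ij.2)))
  have hint : ∀ i (a : M), ∃ c : R, algebraMap R K c = (b : R) • g i (μ a) := by
    intro i a
    have ha : a ∈ Submodule.span R (Set.range m) := hm ▸ Submodule.mem_top
    induction ha using Submodule.span_induction with
    | mem y hy =>
      obtain ⟨j, rfl⟩ := hy
      exact hb (i, j)
    | zero => exact ⟨0, by simp⟩
    | add y z _ _ hy hz =>
      obtain ⟨c, hc⟩ := hy
      obtain ⟨c', hc'⟩ := hz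
      exact ⟨c + c', by rw [map_add, hc, hc', map_add, map_add, smul_add]⟩
    | smul u y _ hy =>
      obtain ⟨c, hc⟩ := hy
      refine ⟨u * c, ?_⟩
      rw [map_mul, hc, map_smul, ← algebraMap_smul K u (μ y), map_smul, smul_eq_mul,
        mul_smul_comm]
  choose l hl using hint
  have hinj := IsFractionRing.injective R K
  refine ⟨fun i => { toFun := l i, map_add' := fun y z => hinj ?_, map_smul' := fun u y => hinj ?_ },
    b, nonZeroDivisors.ne_zero b.2, fun i j => hinj ?_⟩
  · rw [map_add, hl, hl, hl, map_add, map_add, smul_add]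
  · rw [hl, RingHom.id_apply, smul_eq_mul, map_mul, hl, map_smul, ← algebraMap_smul K u (μ y),
      map_smul, smul_eq_mul, mul_smul_comm]
  · refine (hl i (v j)).trans ?_
    rw [hg]
    split_ifs
    · rw [Algebra.smul_def, mul_one]
    · rw [smul_zero, map_zero]

end DualFamily

/-! ### Convergence of mₙ and the comparison of ranks -/

section DifferentialRank

open IsLocalRing

variable {k A B : Type*} [Field k] [PerfectField k] (p : ℕ) [Fact p.Prime] [CharP k p]
  [CommRing A] [CommRing B] [Algebra k A] [Algebra k B]
  [IsLocalRing A] [IsLocalRing B] [IsDomain B] (φ : A →ₐ[k] B) [IsLocalHom φ]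

theorem imageSpan_eq_span (n : ℕ) : imageSpan p φ n = Submodule.span B
    (Set.range fun a : frobPreimage p φ n =>
      (Submodule.Quotient.mk (KaehlerDifferential.D k B (frobRoot p φ n a)) : SepKaehler k B)) := by
  refine le_antisymm (Submodule.span_le.2 ?_) (Submodule.span_mono ?_)
  · rintro _ ⟨ω, rfl⟩
    obtain ⟨ω, rfl⟩ := Submodule.Quotient.mk_surjective _ ω
    have hω : ω ∈ Submodule.span (frobPreimage p φ n)
        (Set.range (KaehlerDifferential.D k (frobPreimage p φ n))) :=
      KaehlerDifferential.span_range_derivation k (frobPreimage p φ n) ▸ Submodule.mem_top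
    induction hω using Submodule.span_induction with
    | mem y hy =>
      obtain ⟨a, rfl⟩ := hy
      rw [SetLike.mem_coe, sepKaehlerMap_D k (frobRoot p φ n) (frobRoot_algebraMap p φ n)]
      exact Submodule.subset_span ⟨a, rfl⟩
    | zero => rw [Submodule.Quotient.mk_zero, map_zero]; exact zero_mem _
    | add y z _ _ hy hz => rw [Submodule.Quotient.mk_add, map_add]; exact add_mem hy hz
    | smul a y _ hy =>
      rw [Submodule.Quotient.mk_smul, map_smulₛₗ]
      exact Submodule.smul_mem _ _ hy
  · rintro _ ⟨a, rfl⟩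
    exact ⟨_, sepKaehlerMap_D k (frobRoot p φ n) (frobRoot_algebraMap p φ n) a⟩

/-- If φₙ(a) = b, then a^p lies in Aₙ₊₁ and φₙ₊₁(a^p) = b. -/
theorem imageSpan_mono : Monotone (imageSpan p φ) := by
  refine monotone_nat_of_le_succ fun n => ?_
  rw [imageSpan_eq_span, imageSpan_eq_span]
  refine Submodule.span_mono ?_
  rintro _ ⟨a, rfl⟩
  have hb : frobRoot p φ n a ^ p ^ (n + 1) = φ ((a : A) ^ p) := by
    rw [pow_succ, pow_mul, frobRoot_pow, map_pow]
  refine ⟨⟨(a : A) ^ p, frobRoot p φ n a, hb⟩, ?_⟩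
  have : frobRoot p φ (n + 1) ⟨(a : A) ^ p, frobRoot p φ n a, hb⟩ = frobRoot p φ n a :=
    pow_p_injective k p (n + 1) ((frobRoot_pow p φ (n + 1) _).trans hb.symm)
  simp only [this]

variable [IsNoetherianRing B] [Module.Finite B (SepKaehler k B)]

theorem rankSeq_mono : Monotone (rankSeq p φ) := fun _ _ h =>
  Submodule.finrank_mono (imageSpan_mono p φ h)

theorem tendsto_rankSeq : Filter.Tendsto (rankSeq p φ) Filter.atTop (nhds (drk p φ)) := by
  refine tendsto_nhds_limUnder ⟨_, tendsto_atTop_ciSup (rankSeq_mono p φ) ?_⟩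
  refine ⟨Module.finrank B (SepKaehler k B), ?_⟩
  rintro _ ⟨n, rfl⟩
  exact Submodule.finrank_le _

/-- ℕ is discrete, so the limit is attained and it suffices to bound each mₙ. -/
theorem exists_rankSeq_eq_drk : ∃ n, rankSeq p φ n = drk p φ := by
  have h := tendsto_rankSeq p φ
  rw [nhds_discrete, Filter.tendsto_pure] at h
  exact h.exists

/-- Composing the dual functionals with the separated universal derivation of B gives the
derivations Dᵢ for a family fᵢ = φₙ(aᵢ). -/
theorem rankSeq_le_grk [Module.Finite k (ResidueField A)] [Module.Finite k (ResidueField B)]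
    {d : ℕ} {x : Fin d → B} (hx : Ideal.span (Set.range x) = maximalIdeal B)
    (hq : IsQuasiRegular x) (n : ℕ) : (rankSeq p φ n : Cardinal) ≤ grk φ := by
  have hr : rankSeq p φ n ≤ Module.finrank B (imageSpan p φ n) := le_rfl
  rw [imageSpan_eq_span] at hr
  obtain ⟨v, hv, hvi⟩ := exists_linearIndependent_mem_of_le_finrank_span _ hr
  obtain ⟨l, h, h0, hl⟩ := exists_dual_family v hvi
  choose a ha using hv
  refine natCast_le_grk p φ hx hq (fun i => frobRoot p φ n (a i)) n
    (fun i => ⟨a i, frobRoot_pow p φ n (a i)⟩)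
    (fun i => ((l i).comp (kaehlerInf k B).mkQ).compDer (KaehlerDifferential.D k B)) h0 ?_
  intro i j
  rw [← hl i j, ← ha j]
  rfl

end DifferentialRank

theorem exists_span_range_eq_maximalIdeal (B : Type*) [CommRing B] [IsRegularLocalRing B] :
    ∃ (d : ℕ) (x : Fin d → B), Ideal.span (Set.range x) = IsLocalRing.maximalIdeal B ∧
      (d : WithBot ℕ∞) ≤ ringKrullDim B := by
  obtain ⟨s, hs, hspan⟩ := Submodule.FG.exists_span_finset_card_eq_spanFinrank
    (IsNoetherian.noetherian (IsLocalRing.maximalIdeal B))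
  refine ⟨s.card, fun i => s.equivFin.symm i, ?_, ?_⟩
  · have : Set.range (fun i => (s.equivFin.symm i : B)) = s := by
      rw [← Function.comp_def Subtype.val, s.equivFin.symm.surjective.range_comp]
      exact Subtype.range_coe
    rw [this]
    exact hspan
  · rw [hs, IsRegularLocalRing.spanFinrank_maximalIdeal]

end LocalRank

theorem mainTheorem7 {k A B : Type*} [Field k] [PerfectField k] (p : ℕ) [Fact p.Prime] [CharP k p]
    [CommRing A] [IsLocalRing A] [IsNoetherianRing A] [Algebra k A]
    [Module.Finite k (IsLocalRing.ResidueField A)]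
    [IsDomain (AdicCompletion (IsLocalRing.maximalIdeal A) A)]
    [CommRing B] [IsDomain B] [IsRegularLocalRing B] [Algebra k B]
    [Module.Finite k (IsLocalRing.ResidueField B)]
    [Module.Finite B (LocalRank.SepKaehler k B)]
    (φ : A →ₐ[k] B) [IsLocalHom φ] :
    Filter.Tendsto (LocalRank.rankSeq p φ) Filter.atTop (nhds (LocalRank.drk p φ)) ∧
      (LocalRank.drk p φ : Cardinal) ≤ LocalRank.grk φ := by
  obtain ⟨d, x, hx, hd⟩ := LocalRank.exists_span_range_eq_maximalIdeal B
  have hq := LocalRank.isQuasiRegular_of_span_range_eq_maximalIdeal d B x hx hd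
  obtain ⟨n, hn⟩ := LocalRank.exists_rankSeq_eq_drk p φ
  exact ⟨LocalRank.tendsto_rankSeq p φ, hn ▸ LocalRank.rankSeq_le_grk p φ hx hq n⟩
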